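/- Let $k\ge 1$, $0<\gamma\le 1$, and let $P$ be a probability measure on $\mathbb R^k$ with a spherically symmetric density $f(x)=h(\|x\|^2)$, where $h:[0,\infty)\to[0,\infty)$ is non-increasing. Let $r>0$ and $\alpha>0$ be determined by $$\frac{2\pi^{k/2}}{\Gamma(k/2)}\int_0^{r}h(u^2)u^{k-1}\,du=\gamma,\qquad \alpha^2=\frac{2\pi^{k/2}}{\gamma k\,\Gamma(k/2)}\int_0^{r}h(u^2)u^{k+1}\,du .$$ Assume that $P$ is unimodal in the sense that $h(u^2)>h(r^2)$ for some $0<u<r$, and that $f$ is continuous and strictly positive on an open neighbourhood of the boundary of $\{x: x'(\alpha^2I)^{-1}x\le (r/\alpha)^2\}$, i.e. of the sphere $\|x\|=r$. Let $S(k)$ be the space of symmetric real $k\times k$ matrices and $\mathrm{PDS}(k)\subset S(k)$ the open set of positive definite ones. For $\theta=(m,G,\rho)\in\mathbb R^k\times\mathrm{PDS}(k)\times\mathbb R$ let $\Lambda(\theta)=(\Lambda_1(\theta),\Lambda_2(\theta),\Lambda_3(\theta))\in\mathbb R^k\times S(k)\times\mathbb R$, where $\Lambda_j(\theta)=\int\Psi_j(y,\theta)\,P(dy)$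 and $$\Psi_1=\mathbf 1_{\{\|G^{-1}(y-m)\|\le \rho\}}G^{-1}(y-m),\quad \Psi_2=\mathbf 1_{\{\|G^{-1}(y-m)\|\le \rho\}}\big(G^{-1}(y-m)(y-m)'G^{-1}-I\big),\quad \Psi_3=\mathbf 1_{\{\|G^{-1}(y-m)\|\le \rho\}}-\gamma .$$ Put $\rho_0=r/\alpha$, $\theta_0=(0,\alpha I,\rho_0)$, and $\nu_0=\nu(\partial B(0,\rho_0))$, where $\nu(d\omega)=\det(\alpha I)\,f(\alpha\omega)\,\sigma_0(d\omega)$ and $\sigma_0$ is the surface measure on the sphere $\partial B(0,\rho_0)=\{\|\omega\|=\rho_0\}$. Define $$\beta_1=\frac1\alpha\Big(\frac{\rho_0}{k}\nu_0-\gamma\Big),\quad \beta_2=\frac{2\rho_0^3\nu_0}{\alpha k(k+2)}-\frac{2\gamma}{\alpha},\quad \beta_3=\frac{\rho_0^3\nu_0}{\alpha k(k+2)}-\frac{\rho_0\nu_0}{k\alpha},$$ $$\beta_4=\frac{\rho_0^2}{k}\nu_0-\nu_0,\quad \beta_5=\frac{\rho_0\nu_0}{k\alpha},\quad \beta_6=\nu_0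 .$$ Then $$\nu_0=\frac{2\pi^{k/2}}{\Gamma(k/2)}h(r^2)r^{k-1}\alpha,\qquad \beta_1<0,\quad \beta_2<0,\quad \beta_6>0,$$ the map $\Lambda$ is (Fréchet) differentiable at $\theta_0$, and its derivative $D=\Lambda'(\theta_0)$, a linear map on $\mathbb R^k\times S(k)\times\mathbb R$, is given by $$D(\eta,A,s)=\big(\beta_1\eta,\ \beta_2A+\beta_3\mathrm{Tr}(A)I+\beta_4sI,\ \beta_5\mathrm{Tr}(A)+\beta_6s\big).$$ Moreover $D$ is invertible, with inverse $$D^{-1}(g,B,t)=\Big(\beta_1^{-1}g,\ \ \beta_2^{-1}B+\frac{\alpha(\beta_3\beta_6-\beta_4\beta_5)}{2\gamma\beta_2\beta_6}\mathrm{Tr}(B)I+\frac{\alpha\beta_4}{2\gamma\beta_6}tI,\ \ \frac{\alpha\beta_5}{2\gamma\beta_6}\mathrm{Tr}(B)-\frac{\alpha(\beta_2+k\beta_3)}{2\gamma\beta_6}t\Big).$$ -/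

import Mathlib

open MeasureTheory Metric Set

noncomputable section

namespace MCD

/-- `ℝᵏ` with its Euclidean norm. -/
abbrev Vec (k : ℕ) : Type := EuclideanSpace ℝ (Fin k)

/-- The space `S(k)` of symmetric `k × k` real matrices. -/
def SymMat (k : ℕ) : Submodule ℝ (Matrix (Fin k) (Fin k) ℝ) where
  carrier := {A | A.IsSymm}
  add_mem' := fun hA hB => Matrix.IsSymm.add hA hB
  zero_mem' := Matrix.isSymm_zero
  smul_mem' := fun c _ hA => Matrix.IsSymm.smul hA c

/-- The identity matrix as an element of `S(k)`. -/
def idSym (k : ℕ) : SymMat k := ⟨1, Matrix.isSymm_one⟩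

/-- The trace on `S(k)`. -/
def tr {k : ℕ} (A : SymMat k) : ℝ := Matrix.trace (A : Matrix (Fin k) (Fin k) ℝ)

/-- `ℝᵏ × S(k) × ℝ`, with its usual (product) topology. The parameter space
`Θ = ℝᵏ × PDS(k) × ℝ` is an open subset of it, and it is the tangent space of `Θ` at each point. -/
abbrev Param (k : ℕ) : Type := Vec k × SymMat k × ℝ

/-- The vector `G⁻¹ (y - m)`. -/
def standardize {k : ℕ} (m : Vec k) (G : SymMat k) (y : Vec k) : Vec k :=
  WithLp.toLp 2 (Matrix.mulVec (G : Matrix (Fin k) (Fin k) ℝ)⁻¹ (WithLp.ofLp (y - m)))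

/-- `{y : ‖G⁻¹ (y - m)‖ ≤ r}` for `θ = (m, G, r)`. -/
def region {k : ℕ} (θ : Param k) : Set (Vec k) :=
  {y | ‖standardize θ.1 θ.2.1 y‖ ≤ θ.2.2}

/-- `Ψ₁(y, θ) = 1{‖G⁻¹(y-m)‖ ≤ r} G⁻¹ (y-m)`. -/
def Psi1 {k : ℕ} (y : Vec k) (θ : Param k) : Vec k :=
  (region θ).indicator (fun y => standardize θ.1 θ.2.1 y) y

/-- `Ψ₂(y, θ) = 1{‖G⁻¹(y-m)‖ ≤ r} (G⁻¹ (y-m)(y-m)' G⁻¹ - I)`. -/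
def Psi2 {k : ℕ} (y : Vec k) (θ : Param k) : Matrix (Fin k) (Fin k) ℝ :=
  (region θ).indicator
    (fun y => (θ.2.1 : Matrix (Fin k) (Fin k) ℝ)⁻¹
        * Matrix.vecMulVec (WithLp.ofLp (y - θ.1)) (WithLp.ofLp (y - θ.1))
        * (θ.2.1 : Matrix (Fin k) (Fin k) ℝ)⁻¹ - 1) y

/-- `Ψ₃(y, θ) = 1{‖G⁻¹(y-m)‖ ≤ r} - γ`. -/
def Psi3 {k : ℕ} (γ : ℝ) (y : Vec k) (θ : Param k) : ℝ :=
  (region θ).indicator (fun _ => (1 : ℝ)) y - γ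

theorem psi2_isSymm {k : ℕ} (y : Vec k) (θ : Param k) : (Psi2 y θ).IsSymm := by
  have hG : (θ.2.1 : Matrix (Fin k) (Fin k) ℝ).transpose = θ.2.1 := θ.2.1.2
  unfold Psi2 Matrix.IsSymm
  by_cases hy : y ∈ region θ
  · rw [Set.indicator_of_mem hy]
    simp [Matrix.transpose_sub, Matrix.transpose_mul, Matrix.transpose_nonsing_inv, hG,
      Matrix.transpose_vecMulVec, Matrix.mul_assoc]
  · rw [Set.indicator_of_notMem hy]
    simp

/-- `Λ₁(θ) = ∫ Ψ₁(y, θ) P(dy)`. -/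
def Lambda1 {k : ℕ} (P : Measure (Vec k)) (θ : Param k) : Vec k := ∫ y, Psi1 y θ ∂P

/-- `Λ₂(θ) = ∫ Ψ₂(y, θ) P(dy)`, the integral being taken entrywise. -/
def Lambda2 {k : ℕ} (P : Measure (Vec k)) (θ : Param k) : SymMat k :=
  ⟨Matrix.of fun i j => ∫ y, Psi2 y θ i j ∂P, by
    change Matrix.IsSymm _
    ext i j
    simp only [Matrix.transpose_apply, Matrix.of_apply]
    congr 1
    funext y
    exact (psi2_isSymm y θ).apply i j⟩

/-- `Λ₃(θ) = ∫ Ψ₃(y, θ) P(dy)`. -/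
def Lambda3 {k : ℕ} (γ : ℝ) (P : Measure (Vec k)) (θ : Param k) : ℝ := ∫ y, Psi3 γ y θ ∂P

/-- `Λ = (Λ₁, Λ₂, Λ₃)`. -/
def Lambda {k : ℕ} (γ : ℝ) (P : Measure (Vec k)) (θ : Param k) : Param k :=
  (Lambda1 P θ, Lambda2 P θ, Lambda3 γ P θ)

/-- The ellipsoid `E(μ, S, ρ) = {x : (x-μ)' S⁻¹ (x-μ) ≤ ρ²}`. -/
def ellipsoid {k : ℕ} (μ : Vec k) (S : Matrix (Fin k) (Fin k) ℝ) (ρ : ℝ) : Set (Vec k) :=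
  {x | dotProduct (WithLp.ofLp (x - μ)) (Matrix.mulVec S⁻¹ (WithLp.ofLp (x - μ))) ≤ ρ ^ 2}

/-- `f` is continuous and strictly positive on an open neighbourhood of the boundary of
the ellipsoid `E(μ, G², ρ)`, where `θ = (μ, G, ρ)`. -/
def ConditionB {k : ℕ} (f : Vec k → ℝ) (θ : Param k) : Prop :=
  ∃ U : Set (Vec k), IsOpen U ∧
    frontier (ellipsoid θ.1 ((θ.2.1 : Matrix (Fin k) (Fin k) ℝ) ^ 2) θ.2.2) ⊆ U ∧
    ContinuousOn f U ∧ ∀ x ∈ U, 0 < f x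

/-- The Lebesgue surface measure on `∂B(0, ρ)`, `ρ > 0`, as a measure on `ℝᵏ`: the image of the
surface measure of the unit sphere under `ω ↦ ρ ω`, multiplied by `ρ ^ (k - 1)`. -/
def surfaceMeasure (k : ℕ) (ρ : ℝ) : Measure (Vec k) :=
  ENNReal.ofReal (ρ ^ (k - 1)) •
    Measure.map (fun ω : sphere (0 : Vec k) 1 => ρ • (ω : Vec k)) (volume : Measure (Vec k)).toSphere

/-- `ν(dω) = det(G) f(G ω + μ) σ(dω)` on `∂B(0, ρ)`, where `θ = (μ, G, ρ)` and `σ` is the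
surface measure on `∂B(0, ρ)`. -/
def boundaryMeasure {k : ℕ} (f : Vec k → ℝ) (θ : Param k) : Measure (Vec k) :=
  (surfaceMeasure k θ.2.2).withDensity fun ω =>
    ENNReal.ofReal ((θ.2.1 : Matrix (Fin k) (Fin k) ℝ).det *
      f (WithLp.toLp 2 (Matrix.mulVec (θ.2.1 : Matrix (Fin k) (Fin k) ℝ) (WithLp.ofLp ω)) + θ.1))

end MCD

end

/-! With N = G⁻¹ and n = G⁻¹m, the truncation region is the ellipsoid ‖N y - n‖ ≤ ρ, and each entry
of Λ is, up to constants, an integral over it of a polynomial of degree at most 2 in N y - n. Near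
the ball (n = 0, N = α⁻¹I) a ray in direction ω meets the ellipsoid in an interval [0, R(w, ω)],
where w = (n, N, ρ) and R, the positive root of a quadratic, is smooth in (w, ω). In polar
coordinates each entry is therefore an integral over the unit sphere of sums of c_p(w, ω) J_p(R(w,
ω)), with J_p(τ) = ∫₀^τ h(u²) u^(k-1+p) du (`integral_ellipsoid_polar`).

All radii equal r at the ball, so J_p needs to be differentiable only at r, which follows from
continuity of h(u²) there. A Lipschitz bound relative to the base point permits differentiation
under the sphere integral (`hasFDerivAt_integral_ellipsoid`). What is left are sphere moments: odd
ones vanish, and those of order 2 and 4 are fixed by rotation invariance. The terms with J_0(r),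
J_2(r) are the bulk contributions, equal to γ and γkα² after multiplication by the area of the
sphere; the terms with h(r²) are the boundary contributions and produce ν₀. The chain rule through θ
↦ (G⁻¹m, G⁻¹, ρ) gives D (`hasFDerivAt_Lambda`).

The signs of β₁ and β₂ come from comparing J_0(r) and J_2(r) with their values for the constant
profile h(r²); unimodality makes the comparison strict (`pow_div_lt_integral`). Apart from the
scalars β₁ on vectors and β₂ on trace-free matrices, D acts on span(I) × ℝ by a 2 × 2 matrix. In its
determinant the terms quadratic in ν₀ cancel, leaving -2γβ₆/α, hence the explicit inverse. -/

noncomputable section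
namespace MCD

variable {k : ℕ}

/-! ### Polar coordinates and moments of the sphere. -/

/-- The surface measure of the unit sphere. -/
abbrev sphereMeas (k : ℕ) : Measure (sphere (0 : Vec k) 1) := (volume : Measure (Vec k)).toSphere

theorem integral_polar (hk : 1 ≤ k) {F : Vec k → ℝ} (hF : Integrable F) :
    ∫ y, F y = ∫ ω, ∫ t in Ioi (0 : ℝ), t ^ (k - 1) * F (t • (ω : Vec k)) ∂volume ∂(sphereMeas k) := by
  have : Nonempty (Fin k) := ⟨⟨0, hk⟩⟩
  have hmp := (volume : Measure (Vec k)).measurePreserving_homeomorphUnitSphereProd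
  have hemb := (homeomorphUnitSphereProd (Vec k)).measurableEmbedding
  set G : sphere (0 : Vec k) 1 × Ioi (0 : ℝ) → ℝ := fun p => F (p.2.1 • (p.1 : Vec k)) with hG
  have hcomp : ∀ x : ({0}ᶜ : Set (Vec k)), G (homeomorphUnitSphereProd (Vec k) x) = F x := by
    intro x
    simp only [hG]
    congr 1
    have hx : ‖(x : Vec k)‖ ≠ 0 := norm_ne_zero_iff.2 x.2
    simp [smul_smul, hx]
  have h1 : ∫ y, F y = ∫ x : ({0}ᶜ : Set (Vec k)), F x.1 ∂(volume.comap Subtype.val) := by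
    rw [integral_subtype_comap (measurableSet_singleton _).compl F, restrict_compl_singleton]
  have hint : Integrable G ((sphereMeas k).prod
      (Measure.volumeIoiPow (Module.finrank ℝ (Vec k) - 1))) := by
    rw [← hmp.integrable_comp_emb hemb]
    have : G ∘ (homeomorphUnitSphereProd (Vec k)) = F ∘ Subtype.val := funext hcomp
    rw [this, ← integrableOn_iff_comap_subtypeVal (measurableSet_singleton _).compl]
    exact hF.integrableOn
  rw [h1]
  simp_rw [← hcomp]
  rw [hmp.integral_comp hemb G, integral_prod G hint]
  congr 1
  funext ω
  simp only [Measure.volumeIoiPow, ENNReal.ofReal, hG]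
  rw [integral_withDensity_eq_integral_smul ((measurable_subtype_coe.pow_const _).real_toNNReal),
    integral_subtype_comap measurableSet_Ioi
      fun a => Real.toNNReal (a ^ (Module.finrank ℝ (Vec k) - 1)) • F (a • (ω : Vec k))]
  refine setIntegral_congr_fun measurableSet_Ioi fun x hx => ?_
  simp only [NNReal.smul_def, finrank_euclideanSpace_fin, smul_eq_mul]
  rw [Real.coe_toNNReal _ (pow_nonneg (le_of_lt hx) _)]

/-- Integral over the unit ball of a positively homogeneous function. -/
theorem integral_ball_homogeneous (hk : 1 ≤ k) (d : ℕ) {q : Vec k → ℝ} (hq : Continuous q)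
    (hom : ∀ t : ℝ, 0 < t → ∀ x, q (t • x) = t ^ d * q x) :
    ∫ y in closedBall (0 : Vec k) 1, q y = (1 / ((k : ℝ) + d)) * ∫ ω, q ω ∂(sphereMeas k) := by
  have hint : IntegrableOn q (closedBall (0 : Vec k) 1) :=
    hq.continuousOn.integrableOn_compact (isCompact_closedBall _ _)
  rw [← integral_indicator measurableSet_closedBall,
    integral_polar hk (hint.integrable_indicator measurableSet_closedBall), ← integral_const_mul]
  congr 1
  funext ω
  have hω : ‖(ω : Vec k)‖ = 1 := by simp
  have : ∀ t ∈ Ioi (0 : ℝ), t ^ (k - 1) * (closedBall (0 : Vec k) 1).indicator q (t • (ω : Vec k))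
      = (Iic (1 : ℝ)).indicator (fun t => t ^ (k - 1 + d) * q ω) t := by
    intro t ht
    have ht' : (0 : ℝ) < t := ht
    by_cases h1 : t ≤ 1
    · rw [indicator_of_mem, indicator_of_mem (by simpa using h1), hom t ht, pow_add]
      · ring
      · simp [norm_smul, hω, abs_of_pos ht', h1]
    · rw [indicator_of_notMem, indicator_of_notMem (by simpa using h1), mul_zero]
      simpa [norm_smul, hω, abs_of_pos ht'] using h1
  rw [setIntegral_congr_fun measurableSet_Ioi this, setIntegral_indicator measurableSet_Iic,
    Ioi_inter_Iic, ← intervalIntegral.integral_of_le zero_le_one,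
    intervalIntegral.integral_mul_const, integral_pow]
  have : ((k - 1 + d : ℕ) : ℝ) + 1 = k + d := by
    rw [Nat.cast_add, Nat.cast_sub hk]; push_cast; ring
  rw [this]
  simp

/-- Turns a sphere integral into a Lebesgue integral over the ball, so that the isometry invariance
of Lebesgue measure passes to the sphere. -/
theorem integral_sphere_homogeneous (hk : 1 ≤ k) (d : ℕ) {q : Vec k → ℝ} (hq : Continuous q)
    (hom : ∀ t : ℝ, 0 < t → ∀ x, q (t • x) = t ^ d * q x) :
    ∫ ω, q ω ∂(sphereMeas k) = ((k : ℝ) + d) * ∫ y in closedBall (0 : Vec k) 1, q y := by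
  rw [integral_ball_homogeneous hk d hq hom]
  have : (0 : ℝ) < k + d := by have : (0 : ℝ) < k := by exact_mod_cast hk
                               positivity
  field_simp

/-- Homogeneous integrals over the sphere are invariant under linear isometries. -/
theorem integral_sphere_comp_isometry (hk : 1 ≤ k) (d : ℕ) {q : Vec k → ℝ} (hq : Continuous q)
    (hom : ∀ t : ℝ, 0 < t → ∀ x, q (t • x) = t ^ d * q x) (U : Vec k ≃ₗᵢ[ℝ] Vec k) :
    ∫ ω, q (U ω) ∂(sphereMeas k) = ∫ ω, q ω ∂(sphereMeas k) := by
  rw [integral_sphere_homogeneous hk d hq hom,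
    integral_sphere_homogeneous (q := fun x => q (U x)) hk d (hq.comp U.continuous)
      (fun t ht x => by rw [map_smul, hom t ht])]
  congr 1
  have := U.measurePreserving.setIntegral_preimage_emb
    U.toHomeomorph.measurableEmbedding q (closedBall 0 1)
  rw [← this]
  simp [LinearIsometryEquiv.preimage_closedBall]

theorem integral_sphere_odd (hk : 1 ≤ k) (d : ℕ) {q : Vec k → ℝ} (hq : Continuous q)
    (hom : ∀ t : ℝ, 0 < t → ∀ x, q (t • x) = t ^ d * q x) (hodd : ∀ x, q (-x) = -q x) :
    ∫ ω, q ω ∂(sphereMeas k) = 0 := by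
  have := integral_sphere_comp_isometry hk d hq hom (LinearIsometryEquiv.neg ℝ)
  simp only [LinearIsometryEquiv.coe_neg, hodd, integral_neg] at this
  linarith

local notation "⟪" x ", " y "⟫" => inner ℝ x y

theorem integrable_sphere {q : Vec k → ℝ} (hq : Continuous q) :
    Integrable (fun ω : sphere (0 : Vec k) 1 => q ω) (sphereMeas k) := by
  have h : Continuous (fun ω : sphere (0 : Vec k) 1 => q ω) := hq.comp continuous_subtype_val
  have : CompactSpace (sphere (0 : Vec k) 1) := isCompact_iff_compactSpace.1 (isCompact_sphere 0 1)
  exact h.integrable_of_hasCompactSupport (HasCompactSupport.of_compactSpace _)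

/-- The reflection in the hyperplane orthogonal to x - y exchanges vectors of equal norm. -/
theorem exists_isometry {x y : Vec k} (h : ‖x‖ = ‖y‖) : ∃ U : Vec k ≃ₗᵢ[ℝ] Vec k, U x = y :=
  ⟨_, Submodule.reflection_sub h⟩

/-- Even moments of a linear functional depend only on its norm. -/
theorem sphere_moment_norm (hk : 1 ≤ k) (d : ℕ) (e : Vec k) (he : ‖e‖ = 1) (x : Vec k) :
    ∫ ω, ⟪x, ω⟫ ^ d ∂(sphereMeas k) = ‖x‖ ^ d * ∫ ω, ⟪e, ω⟫ ^ d ∂(sphereMeas k) := by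
  obtain ⟨U, hU⟩ := exists_isometry (x := ‖x‖ • e) (y := x) (by simp [norm_smul, he])
  rw [← integral_const_mul, ← integral_sphere_comp_isometry hk d
    (q := fun ω => ⟪x, ω⟫ ^ d) (by fun_prop)
    (fun t _ y => by rw [inner_smul_right, mul_pow]) U]
  congr 1
  funext ω
  rw [← mul_pow]
  nth_rw 1 [← hU]
  rw [U.inner_map_map, real_inner_smul_left]

theorem exists_unit (hk : 1 ≤ k) : ∃ e : Vec k, ‖e‖ = 1 :=
  ⟨EuclideanSpace.single ⟨0, hk⟩ 1, by simp⟩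

/-- All unit directions have the same second moment, and the k coordinate moments sum to the total
mass because ‖ω‖² = 1. -/
theorem sphere_moment_two_sq (hk : 1 ≤ k) (x : Vec k) :
    ∫ ω, ⟪x, ω⟫ ^ 2 ∂(sphereMeas k) = (sphereMeas k).real univ / k * ‖x‖ ^ 2 := by
  obtain ⟨e, he⟩ := exists_unit hk
  have hk0 : (0 : ℝ) < k := by exact_mod_cast hk
  rw [sphere_moment_norm hk 2 e he x]
  have h1 : ∑ i : Fin k, ∫ ω, ⟪EuclideanSpace.single i (1 : ℝ), (ω : Vec k)⟫ ^ 2 ∂(sphereMeas k)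
      = (sphereMeas k).real univ := by
    rw [← integral_finsetSum _ fun i _ => integrable_sphere
      (q := fun ω => ⟪EuclideanSpace.single i (1 : ℝ), ω⟫ ^ 2) (by fun_prop)]
    rw [integral_congr_ae (g := fun _ => (1 : ℝ))]
    · simp
    · refine .of_forall fun ω => ?_
      have : ‖(ω : Vec k)‖ ^ 2 = 1 := by simp
      rw [EuclideanSpace.real_norm_sq_eq] at this
      simpa [EuclideanSpace.inner_single_left] using this
  simp only [sphere_moment_norm hk 2 e he (EuclideanSpace.single _ _)] at h1
  simp only [PiLp.norm_single, norm_one, one_pow, one_mul, Finset.sum_const, Finset.card_univ,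
    Fintype.card_fin, nsmul_eq_mul] at h1
  rw [← h1]
  field_simp

/-- Second moments of the surface measure of the unit sphere. -/
theorem sphere_moment_two (hk : 1 ≤ k) (x y : Vec k) :
    ∫ ω, ⟪x, ω⟫ * ⟪y, ω⟫ ∂(sphereMeas k) = (sphereMeas k).real univ / k * ⟪x, y⟫ := by
  have h1 : ∀ ω : Vec k, ⟪x, ω⟫ * ⟪y, ω⟫ = 1 / 4 * (⟪x + y, ω⟫ ^ 2 - ⟪x - y, ω⟫ ^ 2) := by
    intro ω
    rw [inner_add_left, inner_sub_left]; ring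
  simp_rw [h1]
  rw [integral_const_mul, integral_sub
    (integrable_sphere (q := fun ω => ⟪x + y, ω⟫ ^ 2) (by fun_prop))
    (integrable_sphere (q := fun ω => ⟪x - y, ω⟫ ^ 2) (by fun_prop)),
    sphere_moment_two_sq hk, sphere_moment_two_sq hk, norm_add_sq_real, norm_sub_sq_real]
  ring

/-- Polarization: 12a²b² = (a+b)⁴ + (a-b)⁴ - 2a⁴ - 2b⁴, and each fourth moment is ‖·‖⁴ times a
common constant, left undetermined here. -/
theorem sphere_moment_four_sq_aux (hk : 1 ≤ k) (e : Vec k) (he : ‖e‖ = 1) (x y : Vec k) :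
    ∫ ω, ⟪x, ω⟫ ^ 2 * ⟪y, ω⟫ ^ 2 ∂(sphereMeas k) =
      (∫ ω, ⟪e, ω⟫ ^ 4 ∂(sphereMeas k)) / 3 * (‖x‖ ^ 2 * ‖y‖ ^ 2 + 2 * ⟪x, y⟫ ^ 2) := by
  have h1 : ∀ ω : Vec k, ⟪x, ω⟫ ^ 2 * ⟪y, ω⟫ ^ 2
      = 1 / 12 * ((⟪x + y, ω⟫ ^ 4 + ⟪x - y, ω⟫ ^ 4) - 2 * (⟪x, ω⟫ ^ 4 + ⟪y, ω⟫ ^ 4)) := by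
    intro ω
    rw [inner_add_left, inner_sub_left]; ring
  have hi : ∀ z : Vec k, Integrable (fun ω : sphere (0 : Vec k) 1 => ⟪z, (ω : Vec k)⟫ ^ 4)
      (sphereMeas k) := fun z => integrable_sphere (q := fun ω => ⟪z, ω⟫ ^ 4) (by fun_prop)
  simp_rw [h1]
  rw [integral_const_mul, integral_sub ((hi _).fun_add (hi _)) (((hi _).fun_add (hi _)).const_mul 2),
    integral_const_mul, integral_add (hi _) (hi _), integral_add (hi _) (hi _),
    sphere_moment_norm hk 4 e he (x + y), sphere_moment_norm hk 4 e he (x - y),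
    sphere_moment_norm hk 4 e he x, sphere_moment_norm hk 4 e he y]
  have e1 : ‖x + y‖ ^ 4 = (‖x‖ ^ 2 + 2 * ⟪x, y⟫ + ‖y‖ ^ 2) ^ 2 := by
    rw [← norm_add_sq_real]; ring
  have e2 : ‖x - y‖ ^ 4 = (‖x‖ ^ 2 - 2 * ⟪x, y⟫ + ‖y‖ ^ 2) ^ 2 := by
    rw [← norm_sub_sq_real]; ring
  rw [e1, e2]
  ring

/-- The constant is found by summing over an orthonormal basis in the first argument, which reduces
the fourth moment to the second. -/
theorem sphere_moment_four_sq (hk : 1 ≤ k) (x y : Vec k) :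
    ∫ ω, ⟪x, ω⟫ ^ 2 * ⟪y, ω⟫ ^ 2 ∂(sphereMeas k) =
      (sphereMeas k).real univ / (k * (k + 2)) * (‖x‖ ^ 2 * ‖y‖ ^ 2 + 2 * ⟪x, y⟫ ^ 2) := by
  obtain ⟨e, he⟩ := exists_unit hk
  have hk0 : (0 : ℝ) < k := by exact_mod_cast hk
  have h1 : ∑ i : Fin k, ∫ ω, ⟪EuclideanSpace.single i (1 : ℝ), (ω : Vec k)⟫ ^ 2
      * ⟪e, (ω : Vec k)⟫ ^ 2 ∂(sphereMeas k) = ∫ ω, ⟪e, ω⟫ ^ 2 ∂(sphereMeas k) := by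
    rw [← integral_finsetSum _ fun i _ => integrable_sphere
      (q := fun ω => ⟪EuclideanSpace.single i (1 : ℝ), ω⟫ ^ 2 * ⟪e, ω⟫ ^ 2) (by fun_prop)]
    refine integral_congr_ae (.of_forall fun ω => ?_)
    have : ‖(ω : Vec k)‖ ^ 2 = 1 := by simp
    rw [EuclideanSpace.real_norm_sq_eq] at this
    simp [EuclideanSpace.inner_single_left, ← Finset.sum_mul, this]
  have h2 : ∑ i : Fin k, (e i) ^ 2 = 1 := by
    rw [← EuclideanSpace.real_norm_sq_eq, he]; norm_num
  rw [sphere_moment_two_sq hk e, he] at h1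
  simp only [sphere_moment_four_sq_aux hk e he] at h1
  rw [← Finset.mul_sum, Finset.sum_add_distrib, ← Finset.mul_sum] at h1
  simp [EuclideanSpace.inner_single_left, h2, he] at h1
  rw [sphere_moment_four_sq_aux hk e he]
  congr 1
  rw [Measure.toSphere_real_apply_univ, finrank_euclideanSpace_fin, eq_div_iff (by positivity)]
  rw [eq_div_iff (by positivity)] at h1
  rw [← h1]
  ring

/-- Fourth moments of the surface measure of the unit sphere. -/
theorem sphere_moment_four (hk : 1 ≤ k) (x y z w : Vec k) :
    ∫ ω, ⟪x, ω⟫ * ⟪y, ω⟫ * (⟪z, ω⟫ * ⟪w, ω⟫) ∂(sphereMeas k) =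
      (sphereMeas k).real univ / (k * (k + 2)) *
        (⟪x, y⟫ * ⟪z, w⟫ + ⟪x, z⟫ * ⟪y, w⟫ + ⟪x, w⟫ * ⟪y, z⟫) := by
  have hi : ∀ u v : Vec k, Integrable (fun ω : sphere (0 : Vec k) 1 =>
      ⟪u, (ω : Vec k)⟫ ^ 2 * ⟪v, (ω : Vec k)⟫ ^ 2) (sphereMeas k) := fun u v =>
    integrable_sphere (q := fun ω => ⟪u, ω⟫ ^ 2 * ⟪v, ω⟫ ^ 2) (by fun_prop)
  have h1 : ∀ ω : Vec k, ⟪x, ω⟫ * ⟪y, ω⟫ * (⟪z, ω⟫ * ⟪w, ω⟫)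
      = 1 / 16 * ((⟪x + y, ω⟫ ^ 2 * ⟪z + w, ω⟫ ^ 2 + ⟪x - y, ω⟫ ^ 2 * ⟪z - w, ω⟫ ^ 2)
        - (⟪x + y, ω⟫ ^ 2 * ⟪z - w, ω⟫ ^ 2 + ⟪x - y, ω⟫ ^ 2 * ⟪z + w, ω⟫ ^ 2)) := by
    intro ω
    simp only [inner_add_left, inner_sub_left]; ring
  simp_rw [h1]
  rw [integral_const_mul, integral_sub ((hi _ _).fun_add (hi _ _)) ((hi _ _).fun_add (hi _ _)),
    integral_add (hi _ _) (hi _ _), integral_add (hi _ _) (hi _ _)]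
  simp only [sphere_moment_four_sq hk]
  simp only [norm_add_sq_real, norm_sub_sq_real, inner_add_left, inner_sub_left, inner_add_right,
    inner_sub_right]
  ring

/-- The total mass of the surface measure of the unit sphere. -/
theorem sphereMeas_univ (hk : 1 ≤ k) :
    (sphereMeas k).real univ = 2 * Real.pi ^ ((k : ℝ) / 2) / Real.Gamma ((k : ℝ) / 2) := by
  have : Nonempty (Fin k) := ⟨⟨0, hk⟩⟩
  have hk0 : (0 : ℝ) < k := by exact_mod_cast hk
  rw [Measure.toSphere_real_apply_univ, measureReal_def, EuclideanSpace.volume_ball]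
  simp only [finrank_euclideanSpace_fin, ENNReal.ofReal_one, one_pow, one_mul, Fintype.card_fin]
  rw [ENNReal.toReal_ofReal (by positivity), Real.Gamma_add_one (by positivity),
    Real.sqrt_eq_rpow, ← Real.rpow_mul_natCast Real.pi_pos.le, one_div_mul_eq_div]
  have := Real.Gamma_pos_of_pos (half_pos hk0)
  field_simp

/-! ### Ellipsoids near a ball: the radius along a ray. -/

open Filter Topology

/-- A family of functions that is jointly `C¹` near `{x₀} × S` with `S` compact is Lipschitz at
`x₀`, uniformly over `S`. -/
theorem exists_uniform_lipschitz {E X : Type*} [NormedAddCommGroup E] [NormedSpace ℝ E]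
    [NormedAddCommGroup X] [NormedSpace ℝ X] {F : E × X → ℝ} {x₀ : E} {S : Set X}
    (hS : IsCompact S) (hF : ∀ ω ∈ S, ContDiffAt ℝ 1 F (x₀, ω)) :
    ∃ C : ℝ, ∀ᶠ x in 𝓝 x₀, ∀ ω ∈ S, |F (x, ω) - F (x₀, ω)| ≤ C * ‖x - x₀‖ := by
  refine hS.induction_on
    (p := fun s => ∃ C : ℝ, ∀ᶠ x in 𝓝 x₀, ∀ ω ∈ s, |F (x, ω) - F (x₀, ω)| ≤ C * ‖x - x₀‖)
    ⟨0, by simp⟩ ?_ ?_ ?_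
  · rintro s t hst ⟨C, hC⟩
    exact ⟨C, hC.mono fun x hx ω hω => hx ω (hst hω)⟩
  · rintro s t ⟨C, hC⟩ ⟨C', hC'⟩
    refine ⟨max C C', ?_⟩
    filter_upwards [hC, hC'] with x hx hx' ω hω
    rcases hω with hω | hω
    · exact (hx ω hω).trans (by gcongr; exact le_max_left _ _)
    · exact (hx' ω hω).trans (by gcongr; exact le_max_right _ _)
  · intro ω hω
    -- C¹ at a point gives a Lipschitz constant on a product neighbourhood; compactness then glues
    -- finitely many of these.
    obtain ⟨K, t, ht, hK⟩ := (hF ω hω).exists_lipschitzOnWith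
    obtain ⟨u, hu, v, hv, huv⟩ := mem_nhds_prod_iff.1 ht
    refine ⟨v, mem_nhdsWithin_of_mem_nhds hv, K, ?_⟩
    filter_upwards [hu] with x hx ω' hω'
    have := hK.dist_le_mul (x, ω') (huv ⟨hx, hω'⟩) (x₀, ω') (huv ⟨mem_of_mem_nhds hu, hω'⟩)
    simpa [Real.dist_eq, Prod.dist_eq, dist_eq_norm] using this

/-- Parameters `(n, N, ρ)` of the ellipsoids `{y : ‖N y - n‖ ≤ ρ}`. -/
abbrev EllParam (k : ℕ) : Type := Vec k × (Vec k →L[ℝ] Vec k) × ℝ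

/-- The parameter of the ball of radius `α * ρ`. -/
def ballParam (k : ℕ) (α ρ : ℝ) : EllParam k := (0, α⁻¹ • ContinuousLinearMap.id ℝ (Vec k), ρ)

/-- The length of the ray in direction `ω` inside the ellipsoid `{y : ‖N y - n‖ ≤ ρ}`. -/
def radius (w : EllParam k) (ω : Vec k) : ℝ :=
  (⟪w.2.1 ω, w.1⟫ + √(⟪w.2.1 ω, w.1⟫ ^ 2 - ‖w.2.1 ω‖ ^ 2 * (‖w.1‖ ^ 2 - w.2.2 ^ 2)))
    / ‖w.2.1 ω‖ ^ 2

theorem radius_discr_nonneg {w : EllParam k} (ω : Vec k) (hn : ‖w.1‖ < w.2.2) :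
    0 ≤ ⟪w.2.1 ω, w.1⟫ ^ 2 - ‖w.2.1 ω‖ ^ 2 * (‖w.1‖ ^ 2 - w.2.2 ^ 2) := by
  have h1 : ‖w.1‖ ^ 2 < w.2.2 ^ 2 := by gcongr
  have h2 : 0 ≤ ‖w.2.1 ω‖ ^ 2 * (w.2.2 ^ 2 - ‖w.1‖ ^ 2) := mul_nonneg (by positivity) (by linarith)
  nlinarith [sq_nonneg ⟪w.2.1 ω, w.1⟫]

/-- The boundary equation ‖R N ω - n‖² = ρ², kept as a polynomial identity for later implicit
differentiation. -/
theorem radius_eq {w : EllParam k} {ω : Vec k} (hn : ‖w.1‖ < w.2.2) (hω : w.2.1 ω ≠ 0) :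
    ‖w.2.1 ω‖ ^ 2 * radius w ω ^ 2 - 2 * ⟪w.2.1 ω, w.1⟫ * radius w ω + (‖w.1‖ ^ 2 - w.2.2 ^ 2)
      = 0 := by
  have ha : ‖w.2.1 ω‖ ≠ 0 := norm_ne_zero_iff.2 hω
  have hs := Real.sq_sqrt (radius_discr_nonneg ω hn)
  unfold radius
  field_simp
  linear_combination hs

/-- Since ‖n‖ < ρ, the origin is interior and the quadratic in t has roots of opposite sign; for t ≥
0 only the larger root matters. -/
theorem norm_smul_sub_le_iff {w : EllParam k} {ω : Vec k} (hn : ‖w.1‖ < w.2.2) (hω : w.2.1 ω ≠ 0)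
    {t : ℝ} (ht : 0 ≤ t) : ‖t • w.2.1 ω - w.1‖ ≤ w.2.2 ↔ t ≤ radius w ω := by
  have hρ : 0 < w.2.2 := (norm_nonneg _).trans_lt hn
  have ha : 0 < ‖w.2.1 ω‖ ^ 2 := by have := norm_pos_iff.2 hω; positivity
  have h1 : ‖w.1‖ ^ 2 < w.2.2 ^ 2 := by gcongr
  have hD := Real.sq_sqrt (radius_discr_nonneg ω hn)
  have hD0 := Real.sqrt_nonneg (⟪w.2.1 ω, w.1⟫ ^ 2 - ‖w.2.1 ω‖ ^ 2 * (‖w.1‖ ^ 2 - w.2.2 ^ 2))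
  unfold radius
  rw [le_div_iff₀ ha]
  set s := √(⟪w.2.1 ω, w.1⟫ ^ 2 - ‖w.2.1 ω‖ ^ 2 * (‖w.1‖ ^ 2 - w.2.2 ^ 2))
  set b := ⟪w.2.1 ω, w.1⟫ with hb
  -- This is the strict opposition of signs of the roots (b ± s) / ‖N ω‖².
  have hsb : |b| < s := by
    apply abs_lt_of_sq_lt_sq _ hD0
    nlinarith [mul_pos ha (sub_pos.2 h1)]
  have hexp : ‖t • w.2.1 ω - w.1‖ ^ 2 = ‖w.2.1 ω‖ ^ 2 * t ^ 2 - 2 * b * t + ‖w.1‖ ^ 2 := by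
    rw [norm_sub_sq_real, norm_smul, real_inner_smul_left, mul_pow, Real.norm_eq_abs, sq_abs]
    ring
  rw [← sq_le_sq₀ (norm_nonneg _) hρ.le, hexp]
  set a := ‖w.2.1 ω‖ ^ 2
  have hat : 0 ≤ a * t := by positivity
  have key : a * (a * t ^ 2 - 2 * b * t + ‖w.1‖ ^ 2 - w.2.2 ^ 2) = (a * t - b) ^ 2 - s ^ 2 := by
    rw [hD]; ring
  constructor
  · intro h
    have : (a * t - b) ^ 2 ≤ s ^ 2 := by nlinarith
    linarith [le_abs_self (a * t - b), abs_le_of_sq_le_sq this hD0]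
  · intro h
    have : (a * t - b) ^ 2 ≤ s ^ 2 := by
      apply sq_le_sq'
      · linarith [(abs_lt.1 hsb).2, (abs_lt.1 hsb).1]
      · linarith
    nlinarith

theorem eventually_ellParam {α ρ : ℝ} (hα : 0 < α) (hρ : 0 < ρ) :
    ∀ᶠ w in 𝓝 (ballParam k α ρ), ‖w.1‖ < w.2.2 ∧ ∀ ω : Vec k, ω ≠ 0 → w.2.1 ω ≠ 0 := by
  have h1 : ∀ᶠ w in 𝓝 (ballParam k α ρ), ‖w.1‖ < w.2.2 := by
    have : Continuous fun w : EllParam k => w.2.2 - ‖w.1‖ := by fun_prop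
    filter_upwards [(this.tendsto (ballParam k α ρ)).eventually_const_lt (u := 0)
      (by simpa [ballParam] using hρ)] with w hw
    linarith
  have h2 : ∀ᶠ w in 𝓝 (ballParam k α ρ),
      ‖w.2.1 - α⁻¹ • ContinuousLinearMap.id ℝ (Vec k)‖ < α⁻¹ := by
    have : Continuous fun w : EllParam k => ‖w.2.1 - α⁻¹ • ContinuousLinearMap.id ℝ (Vec k)‖ := by
      fun_prop
    exact (this.tendsto (ballParam k α ρ)).eventually_lt_const (by simpa [ballParam] using hα)
  filter_upwards [h1, h2] with w hw1 hw2
  refine ⟨hw1, fun ω hω h0 => ?_⟩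
  -- If N ω = 0, then N - α⁻¹I stretches ω by exactly α⁻¹, against the norm bound.
  have h3 := (w.2.1 - α⁻¹ • ContinuousLinearMap.id ℝ (Vec k)).le_opNorm ω
  simp only [_root_.sub_apply, h0, _root_.smul_apply,
    ContinuousLinearMap.id_apply, zero_sub, norm_neg, norm_smul, norm_inv, Real.norm_eq_abs,
    abs_of_pos hα] at h3
  have : 0 < ‖ω‖ := norm_pos_iff.2 hω
  nlinarith

theorem radius_ballParam {α ρ : ℝ} (hα : 0 < α) (hρ : 0 < ρ) {ω : Vec k} (hω : ‖ω‖ = 1) :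
    radius (ballParam k α ρ) ω = α * ρ := by
  simp only [radius, ballParam, _root_.smul_apply, ContinuousLinearMap.id_apply,
    inner_zero_right, norm_zero, norm_smul, hω, norm_inv, Real.norm_eq_abs, abs_of_pos hα]
  have : (0 : ℝ) ^ 2 - (α⁻¹ * 1) ^ 2 * (0 ^ 2 - ρ ^ 2) = (α⁻¹ * ρ) ^ 2 := by ring
  rw [this, Real.sqrt_sq (by positivity)]
  field_simp
  ring

/-- At the ball the discriminant is (ρ/α)² > 0, so the square root is smooth there. -/
theorem contDiffAt_radius {α ρ : ℝ} (hα : 0 < α) (hρ : 0 < ρ) {ω : Vec k} (hω : ‖ω‖ = 1) :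
    ContDiffAt ℝ 2 (fun p : EllParam k × Vec k => radius p.1 p.2) (ballParam k α ρ, ω) := by
  have happ : ContDiff ℝ 2 (fun p : EllParam k × Vec k => p.1.2.1 p.2) := by fun_prop
  have hb : ContDiff ℝ 2 (fun p : EllParam k × Vec k => ⟪p.1.2.1 p.2, p.1.1⟫) :=
    happ.inner ℝ (contDiff_fst.comp contDiff_fst)
  have ha : ContDiff ℝ 2 (fun p : EllParam k × Vec k => ‖p.1.2.1 p.2‖ ^ 2) := happ.norm_sq ℝ
  have hc : ContDiff ℝ 2 (fun p : EllParam k × Vec k => ‖p.1.1‖ ^ 2 - p.1.2.2 ^ 2) := by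
    have : ContDiff ℝ 2 (fun p : EllParam k × Vec k => ‖p.1.1‖ ^ 2) :=
      (contDiff_fst.comp contDiff_fst).norm_sq ℝ
    fun_prop
  unfold radius
  refine ContDiffAt.div (hb.contDiffAt.add (ContDiffAt.sqrt
    ((hb.pow 2).sub (ha.mul hc)).contDiffAt ?_)) ha.contDiffAt ?_
  · simp [ballParam, norm_smul, hω, hα.ne', hρ.ne']
  · simp [ballParam, norm_smul, hω, hα.ne']

/-- Implicit differentiation of the boundary equation at n = 0, N = α⁻¹I; the coefficient of the
unknown derivative is 2ρ/α ≠ 0. -/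
theorem fderiv_radius_apply {α ρ : ℝ} (hα : 0 < α) (hρ : 0 < ρ) {ω : Vec k} (hω : ‖ω‖ = 1)
    (v : EllParam k) :
    fderiv ℝ (fun w => radius w ω) (ballParam k α ρ) v =
      α * v.2.2 + α * ⟪ω, v.1⟫ - α * (α * ρ) * ⟪ω, v.2.1 ω⟫ := by
  set w₀ := ballParam k α ρ with hw₀
  have hR : HasFDerivAt (fun w => radius w ω) (fderiv ℝ (fun w => radius w ω) w₀) w₀ := by
    have := (contDiffAt_radius hα hρ hω).comp w₀ (g := fun p : EllParam k × Vec k => radius p.1 p.2)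
      (f := fun w => (w, ω)) (by fun_prop)
    exact (this.differentiableAt (by norm_num)).hasFDerivAt
  set R' := fderiv ℝ (fun w => radius w ω) w₀
  let evalω : EllParam k →L[ℝ] Vec k := (ContinuousLinearMap.apply ℝ (Vec k) ω) ∘L
    (ContinuousLinearMap.fst ℝ _ _ ∘L ContinuousLinearMap.snd ℝ _ _)
  have hN : HasFDerivAt (fun w : EllParam k => w.2.1 ω) evalω w₀ := evalω.hasFDerivAt
  have hn : HasFDerivAt (fun w : EllParam k => w.1) (ContinuousLinearMap.fst ℝ _ _) w₀ :=
    hasFDerivAt_fst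
  let projρ : EllParam k →L[ℝ] ℝ := ContinuousLinearMap.snd ℝ _ _ ∘L ContinuousLinearMap.snd ℝ _ _
  have hs : HasFDerivAt (fun w : EllParam k => w.2.2) projρ w₀ := projρ.hasFDerivAt
  have htot := (((hN.norm_sq).mul (hR.pow 2)).sub
    (((hN.inner ℝ hn).const_mul 2).mul hR)).add (hn.norm_sq.sub (hs.pow 2))
  have hzero : (fun w : EllParam k => ‖w.2.1 ω‖ ^ 2 * radius w ω ^ 2
      - 2 * ⟪w.2.1 ω, w.1⟫ * radius w ω + (‖w.1‖ ^ 2 - w.2.2 ^ 2)) =ᶠ[𝓝 w₀] fun _ => 0 := by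
    filter_upwards [eventually_ellParam hα hρ] with w hw
    exact radius_eq hw.1 (hw.2 ω (by rintro rfl; simp at hω))
  have h0 := htot.unique ((hasFDerivAt_const (0 : ℝ) w₀).congr_of_eventuallyEq hzero)
  have h1 := congrArg (fun L => L v) h0
  have hr := radius_ballParam (k := k) hα hρ hω
  rw [← hw₀] at hr
  simp [hr] at h1
  simp [hw₀, ballParam, norm_smul, hω, abs_of_pos hα, real_inner_smul_left] at h1
  have e1 : evalω v = v.2.1 ω := rfl
  have e2 : projρ v = v.2.2 := rfl
  rw [e1, e2] at h1
  have hα' : α ≠ 0 := hα.ne'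
  have hρ' : ρ ≠ 0 := hρ.ne'
  field_simp at h1
  apply mul_left_cancel₀ (mul_ne_zero two_ne_zero hρ')
  linear_combination h1

/-! ### Differentiating integrals over ellipsoids. -/

/-- The truncated radial moments `∫₀^τ g(u) u^(k-1+p) du`. -/
def radialMoment (k : ℕ) (g : ℝ → ℝ) (p : ℕ) (τ : ℝ) : ℝ := ∫ u in (0 : ℝ)..τ, g u * u ^ (k - 1 + p)

section RadialMoment

variable {g : ℝ → ℝ} {M : ℝ}

theorem intervalIntegrable_mul_pow (hg : Measurable g) (hM : ∀ u, |g u| ≤ M) (m : ℕ) (a b : ℝ) :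
    IntervalIntegrable (fun u => g u * u ^ m) volume a b := by
  have h1 : IntervalIntegrable (fun u : ℝ => u ^ m) volume a b := intervalIntegral.intervalIntegrable_pow m
  rw [intervalIntegrable_iff] at h1 ⊢
  exact h1.bdd_mul (c := M) hg.aestronglyMeasurable (.of_forall hM)

theorem continuous_radialMoment (hg : Measurable g) (hM : ∀ u, |g u| ≤ M) (p : ℕ) :
    Continuous (radialMoment k g p) :=
  intervalIntegral.continuous_primitive (fun a b => intervalIntegrable_mul_pow hg hM _ a b) 0

/-- The fundamental theorem of calculus at a single point: g may jump elsewhere. -/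
theorem hasDerivAt_radialMoment (hg : Measurable g) (hM : ∀ u, |g u| ≤ M) (p : ℕ) {r : ℝ}
    (hgc : ContinuousAt g r) :
    HasDerivAt (radialMoment k g p) (g r * r ^ (k - 1 + p)) r :=
  intervalIntegral.integral_hasDerivAt_right (intervalIntegrable_mul_pow hg hM _ 0 r)
    (hg.mul (measurable_id.pow_const _)).stronglyMeasurable.stronglyMeasurableAtFilter
    (hgc.mul (continuousAt_id.pow _))

/-- Integration over an ellipsoid in polar coordinates. -/
theorem integral_ellipsoid_polar (hk : 1 ≤ k) (hg : Measurable g) (hM : ∀ u, |g u| ≤ M)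
    (hgi : Integrable (fun y : Vec k => g ‖y‖)) {φ : Vec k → ℝ} (hφ : Continuous φ) (d : ℕ)
    {c : ℕ → EllParam k → Vec k → ℝ}
    (hφc : ∀ w ω t, φ (t • w.2.1 ω - w.1) = ∑ p ∈ Finset.range d, c p w ω * t ^ p)
    {w : EllParam k} (hw : ‖w.1‖ < w.2.2) (hw' : ∀ ω : Vec k, ω ≠ 0 → w.2.1 ω ≠ 0) :
    ∫ y in {y | ‖w.2.1 y - w.1‖ ≤ w.2.2}, φ (w.2.1 y - w.1) * g ‖y‖ =
      ∫ ω, ∑ p ∈ Finset.range d, c p w ω * radialMoment k g p (radius w ω) ∂(sphereMeas k) := by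
  have hmeas : MeasurableSet {y | ‖w.2.1 y - w.1‖ ≤ w.2.2} :=
    (isClosed_le (by fun_prop) continuous_const).measurableSet
  obtain ⟨C, hC⟩ := (isCompact_closedBall (0 : Vec k) w.2.2).exists_bound_of_continuousOn
    hφ.continuousOn
  have hint : IntegrableOn (fun y => φ (w.2.1 y - w.1) * g ‖y‖) {y | ‖w.2.1 y - w.1‖ ≤ w.2.2} := by
    refine hgi.integrableOn.bdd_mul (c := C) ?_ ?_
    · exact (hφ.comp (by fun_prop)).aestronglyMeasurable
    · filter_upwards [ae_restrict_mem hmeas] with y hy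
      exact hC _ (by simpa using hy)
  rw [← integral_indicator hmeas, integral_polar hk (hint.integrable_indicator hmeas)]
  congr 1
  funext ω
  have hω : ‖(ω : Vec k)‖ = 1 := by simp
  have hω0 : (ω : Vec k) ≠ 0 := by intro h; simp [h] at hω
  have hr0 : 0 ≤ radius w ω := by
    rw [← norm_smul_sub_le_iff hw (hw' _ hω0) le_rfl]
    simpa using hw.le
  have : ∀ t ∈ Ioi (0 : ℝ), t ^ (k - 1) * {y | ‖w.2.1 y - w.1‖ ≤ w.2.2}.indicator
      (fun y => φ (w.2.1 y - w.1) * g ‖y‖) (t • (ω : Vec k))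
      = (Iic (radius w ω)).indicator
        (fun t => ∑ p ∈ Finset.range d, c p w ω * (g t * t ^ (k - 1 + p))) t := by
    intro t ht
    have ht' : (0 : ℝ) < t := ht
    have hiff := norm_smul_sub_le_iff hw (hw' _ hω0) ht'.le
    by_cases h1 : t ≤ radius w ω
    · rw [indicator_of_mem (by simpa using hiff.2 h1), indicator_of_mem (by simpa using h1),
        map_smul, hφc, norm_smul, hω, mul_one, Real.norm_of_nonneg ht'.le, Finset.sum_mul,
        Finset.mul_sum]
      refine Finset.sum_congr rfl fun p _ => ?_
      rw [pow_add]
      ring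
    · rw [indicator_of_notMem (by simpa using fun h => h1 (hiff.1 h)),
        indicator_of_notMem (by simpa using h1), mul_zero]
  rw [setIntegral_congr_fun measurableSet_Ioi this, setIntegral_indicator measurableSet_Iic,
    Ioi_inter_Iic, ← intervalIntegral.integral_of_le hr0, intervalIntegral.integral_finsetSum
      fun p _ => (intervalIntegrable_mul_pow hg hM _ _ _).const_mul _]
  simp only [intervalIntegral.integral_const_mul, radialMoment]

/-- A product rule for Lipschitz bounds at a point; δ ≤ 1 absorbs the quadratic error. -/
theorem abs_mul_sub_mul_le {a b a₀ b₀ A B A₀ B₀ δ : ℝ} (ha : |a - a₀| ≤ A * δ) (hb : |b - b₀| ≤ B * δ)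
    (ha₀ : |a₀| ≤ A₀) (hb₀ : |b₀| ≤ B₀) (hδ : 0 ≤ δ) (hδ1 : δ ≤ 1) (hA : 0 ≤ A) (hB : 0 ≤ B) :
    |a * b - a₀ * b₀| ≤ (A * B + A * B₀ + A₀ * B) * δ := by
  have e : a * b - a₀ * b₀ = (a - a₀) * (b - b₀) + (a - a₀) * b₀ + a₀ * (b - b₀) := by ring
  have h1 : |(a - a₀) * (b - b₀)| ≤ A * δ * (B * δ) := by rw [abs_mul]; gcongr
  have h2 : |(a - a₀) * b₀| ≤ A * δ * B₀ := by rw [abs_mul]; gcongr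
  have h3 : |a₀ * (b - b₀)| ≤ A₀ * (B * δ) := by rw [abs_mul]; gcongr; exact (abs_nonneg _).trans ha₀
  have h4 : A * δ * (B * δ) ≤ A * B * δ := by
    have : A * B * δ * δ ≤ A * B * δ * 1 := by gcongr
    linarith
  rw [e]
  refine (abs_add_three _ _ _).trans ?_
  linarith

/-- The composite with the radius need not be C¹ near the ball, since g is only continuous at αρ.
Comparison with the base point suffices: the base radius is αρ for every ω, so one derivative bound
there serves all directions. -/
theorem uniform_lipschitz_radialMoment {α ρ : ℝ} (hα : 0 < α) (hρ : 0 < ρ)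
    (hg : Measurable g) (hM : ∀ u, |g u| ≤ M) (hgc : ContinuousAt g (α * ρ)) (p : ℕ)
    {c : EllParam k → Vec k → ℝ}
    (hc : ContDiff ℝ 2 (fun x : EllParam k × Vec k => c x.1 x.2)) :
    ∃ C : ℝ, ∀ᶠ w in 𝓝 (ballParam k α ρ), ∀ ω ∈ sphere (0 : Vec k) 1,
      |c w ω * radialMoment k g p (radius w ω)
        - c (ballParam k α ρ) ω * radialMoment k g p (radius (ballParam k α ρ) ω)|
        ≤ C * ‖w - ballParam k α ρ‖ := by
  have hS := isCompact_sphere (0 : Vec k) 1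
  set w₀ := ballParam k α ρ with hw₀
  obtain ⟨A, hA⟩ := exists_uniform_lipschitz (x₀ := w₀) hS
    fun ω _ => (hc.of_le (by norm_num)).contDiffAt
  obtain ⟨R, hR⟩ := exists_uniform_lipschitz (x₀ := w₀) hS
    (F := fun p : EllParam k × Vec k => radius p.1 p.2)
    fun ω hω => (contDiffAt_radius hα hρ (by simpa using hω)).of_le (by norm_num)
  obtain ⟨A₀, hA₀⟩ := hS.exists_bound_of_continuousOn (f := fun ω => c w₀ ω)
    (hc.continuous.comp (by fun_prop : Continuous fun ω : Vec k => (w₀, ω))).continuousOn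
  obtain ⟨K, hK⟩ := ((hasDerivAt_radialMoment (k := k) hg hM p hgc).isBigO_sub).bound
  have hnorm : Tendsto (fun w => ‖w - w₀‖) (𝓝 w₀) (𝓝 0) := by
    simpa using (continuous_id.sub continuous_const).norm.tendsto (x := w₀) (f := fun w => ‖w - w₀‖)
  obtain ⟨ε, hε, hball⟩ := Metric.eventually_nhds_iff.1 hK
  have hsmall : ∀ᶠ w in 𝓝 w₀, (|R| + 1) * ‖w - w₀‖ < ε := by
    have : Tendsto (fun w => (|R| + 1) * ‖w - w₀‖) (𝓝 w₀) (𝓝 0) := by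
      simpa using hnorm.const_mul (|R| + 1)
    exact this.eventually_lt_const hε
  refine ⟨|A| * (|K| * |R|) + |A| * |radialMoment k g p (α * ρ)| + A₀ * (|K| * |R|), ?_⟩
  filter_upwards [hA, hR, hsmall, hnorm.eventually_le_const one_pos] with w hAw hRw hsw h1 ω hω
  have hω1 : ‖ω‖ = 1 := by simpa using hω
  have hr0 : radius w₀ ω = α * ρ := radius_ballParam hα hρ hω1
  have hRw' := hRw ω hω
  simp only [hr0] at hRw' ⊢
  have hRw2 : |radius w ω - α * ρ| ≤ |R| * ‖w - w₀‖ := hRw'.trans (by gcongr; exact le_abs_self _)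
  refine abs_mul_sub_mul_le ((hAw ω hω).trans (by gcongr; exact le_abs_self _)) ?_ (hA₀ ω hω) le_rfl
    (norm_nonneg _) h1 (abs_nonneg _) (by positivity)
  have hd : dist (radius w ω) (α * ρ) < ε := by
    rw [Real.dist_eq]
    nlinarith [norm_nonneg (w - w₀)]
  calc _ ≤ K * ‖radius w ω - α * ρ‖ := hball hd
    _ ≤ |K| * (|R| * ‖w - w₀‖) := by
        gcongr
        · exact le_abs_self _
        · exact hRw2
    _ = _ := by ring

/-- Derivative, at a ball, of the integral over ellipsoids of a polynomial in the standardized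
variable. -/
theorem hasFDerivAt_integral_ellipsoid (hk : 1 ≤ k) {α ρ : ℝ} (hα : 0 < α) (hρ : 0 < ρ)
    (hg : Measurable g) (hM : ∀ u, |g u| ≤ M)
    (hgi : Integrable (fun y : Vec k => g ‖y‖)) (hgc : ContinuousAt g (α * ρ))
    {φ : Vec k → ℝ} (hφ : Continuous φ) (d : ℕ) {c : ℕ → EllParam k → Vec k → ℝ}
    (hc : ∀ p, ContDiff ℝ 2 (fun x : EllParam k × Vec k => c p x.1 x.2))
    (hφc : ∀ w ω t, φ (t • w.2.1 ω - w.1) = ∑ p ∈ Finset.range d, c p w ω * t ^ p) :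
    ∃ L : EllParam k →L[ℝ] ℝ,
      HasFDerivAt (fun w : EllParam k =>
        ∫ y in {y | ‖w.2.1 y - w.1‖ ≤ w.2.2}, φ (w.2.1 y - w.1) * g ‖y‖) L (ballParam k α ρ) ∧
      ∀ v, L v = ∫ ω, ∑ p ∈ Finset.range d,
        (fderiv ℝ (fun w => c p w ω) (ballParam k α ρ) v * radialMoment k g p (α * ρ) +
          c p (ballParam k α ρ) ω * (g (α * ρ) * (α * ρ) ^ (k - 1 + p) *
            (α * v.2.2 + α * ⟪(ω : Vec k), v.1⟫ - α * (α * ρ) * ⟪(ω : Vec k), v.2.1 ω⟫)))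
        ∂(sphereMeas k) := by
  set w₀ := ballParam k α ρ with hw₀
  let F : EllParam k → sphere (0 : Vec k) 1 → ℝ := fun w ω =>
    ∑ p ∈ Finset.range d, c p w ω * radialMoment k g p (radius w ω)
  let F' : sphere (0 : Vec k) 1 → EllParam k →L[ℝ] ℝ := fun ω => ∑ p ∈ Finset.range d,
    (c p w₀ ω • (g (α * ρ) * (α * ρ) ^ (k - 1 + p)) • fderiv ℝ (fun w => radius w ω) w₀ +
      radialMoment k g p (α * ρ) • fderiv ℝ (fun w => c p w ω) w₀)
  have hcω : ∀ p, Continuous fun ω : Vec k => fderiv ℝ (fun w => c p w ω) w₀ := fun p =>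
    (ContDiff.fderiv (n := 0) (m := 2) (f := fun ω w => c p w ω) (g := fun _ => w₀)
      ((hc p).comp (contDiff_snd.prodMk contDiff_fst)) contDiff_const (by norm_num)).continuous
  have hRω : ∀ ω : Vec k, ‖ω‖ = 1 → ContinuousAt (fun ω => fderiv ℝ (fun w => radius w ω) w₀) ω :=
    fun ω hω => (ContDiffAt.fderiv (m := 0) (n := 2) (f := fun ω w => radius w ω) (g := fun _ => w₀)
      ((contDiffAt_radius hα hρ hω).comp (ω, w₀) (f := fun p : Vec k × EllParam k => (p.2, p.1))
        (contDiff_snd.prodMk contDiff_fst).contDiffAt)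
      contDiffAt_const (by norm_num)).continuousAt
  have hF'c : Continuous F' := by
    have : ContinuousAdd (EllParam k →L[ℝ] ℝ) :=
      (inferInstance : IsTopologicalAddGroup (EllParam k →L[ℝ] ℝ)).toContinuousAdd
    refine continuous_finsetSum _ fun p _ => ?_
    have h1 : Continuous fun ω : sphere (0 : Vec k) 1 => fderiv ℝ (fun w => radius w ω) w₀ :=
      continuous_iff_continuousAt.2 fun ω => (hRω ω (by simp)).comp continuous_subtype_val.continuousAt
    have h2 : Continuous fun ω : sphere (0 : Vec k) 1 => fderiv ℝ (fun w => c p w ω) w₀ :=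
      (hcω p).comp continuous_subtype_val
    have h3 : Continuous fun ω : sphere (0 : Vec k) 1 => c p w₀ ω :=
      (hc p).continuous.comp (by fun_prop : Continuous fun ω : sphere (0 : Vec k) 1 => (w₀, (ω : Vec k)))
    fun_prop
  have hmeas : ∀ w, Measurable (F w) := by
    intro w
    refine Finset.measurable_sum _ fun p _ => ?_
    have h1 : Measurable fun ω : sphere (0 : Vec k) 1 => c p w ω :=
      ((hc p).continuous.comp
        (by fun_prop : Continuous fun ω : sphere (0 : Vec k) 1 => (w, (ω : Vec k)))).measurable
    have h2 : Measurable fun ω : sphere (0 : Vec k) 1 => radius w ω := by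
      unfold radius
      have : Measurable fun ω : sphere (0 : Vec k) 1 => w.2.1 (ω : Vec k) := by fun_prop
      fun_prop
    exact h1.mul ((continuous_radialMoment hg hM p).measurable.comp h2)
  choose C hC using fun p => uniform_lipschitz_radialMoment (k := k) hα hρ hg hM hgc p (hc p)
  have hlip : ∀ᶠ w in 𝓝 w₀, ∀ ω : sphere (0 : Vec k) 1,
      ‖F w ω - F w₀ ω‖ ≤ (∑ p ∈ Finset.range d, C p) * ‖w - w₀‖ := by
    filter_upwards [(Filter.eventually_all_finset (Finset.range d)).2 fun p _ => hC p] with w hw ω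
    simp only [F, ← Finset.sum_sub_distrib, Finset.sum_mul]
    exact (norm_sum_le _ _).trans (Finset.sum_le_sum fun p hp => hw p hp ω ω.2)
  have hF0 : Integrable (F w₀) (sphereMeas k) := by
    have : F w₀ = fun ω : sphere (0 : Vec k) 1 =>
        ∑ p ∈ Finset.range d, c p w₀ ω * radialMoment k g p (α * ρ) := by
      funext ω
      simp only [F, hw₀, radius_ballParam hα hρ (norm_eq_of_mem_sphere ω)]
    rw [this]
    refine integrable_finsetSum _ fun p _ => Integrable.mul_const ?_ _
    exact integrable_sphere (q := fun ω => c p w₀ ω)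
      ((hc p).continuous.comp (by fun_prop : Continuous fun ω : Vec k => (w₀, ω)))
  have hdiff : ∀ ω : sphere (0 : Vec k) 1, HasFDerivAt (fun w => F w ω) (F' ω) w₀ := by
    intro ω
    have hω : ‖(ω : Vec k)‖ = 1 := by simp
    have hRd : HasFDerivAt (fun w => radius w ω) (fderiv ℝ (fun w => radius w (ω : Vec k)) w₀) w₀ :=
      (((contDiffAt_radius hα hρ hω).comp w₀ (f := fun w => (w, (ω : Vec k)))
        (by fun_prop)).differentiableAt (by norm_num)).hasFDerivAt
    refine HasFDerivAt.fun_sum fun p _ => ?_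
    have hcd : HasFDerivAt (fun w => c p w ω) (fderiv ℝ (fun w => c p w (ω : Vec k)) w₀) w₀ :=
      (((hc p).comp (by fun_prop : ContDiff ℝ 2 fun w : EllParam k => (w, (ω : Vec k)))).differentiable
        (by norm_num) w₀).hasFDerivAt
    have hr := radius_ballParam (k := k) hα hρ hω
    have hJ := hasDerivAt_radialMoment (k := k) hg hM p hgc
    rw [← hw₀] at hr
    rw [← hr] at hJ
    have := hcd.mul (hJ.comp_hasFDerivAt w₀ hRd)
    simpa only [hr, Function.comp_def, Pi.mul_def] using this
  -- This form of differentiation under the integral needs the Lipschitz bound only between w and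
  -- the base point.
  have hmain := hasFDerivAt_integral_of_dominated_loc_of_lip' (μ := sphereMeas k) (F := F) (F' := F')
    (bound := fun _ => ∑ p ∈ Finset.range d, C p) hlip
    (fun w _ => (hmeas w).aestronglyMeasurable) hF0 hF'c.aestronglyMeasurable
    (.of_forall fun ω w hw => hw ω) (integrable_const _) (.of_forall hdiff)
  refine ⟨∫ ω, F' ω ∂(sphereMeas k), hmain.2.congr_of_eventuallyEq ?_, fun v => ?_⟩
  · filter_upwards [eventually_ellParam (k := k) hα hρ] with w hw
    exact integral_ellipsoid_polar hk hg hM hgi hφ d hφc hw.1 hw.2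
  · rw [ContinuousLinearMap.integral_apply hmain.1]
    congr 1
    funext ω
    have hω : ‖(ω : Vec k)‖ = 1 := by simp
    simp only [F', _root_.sum_apply, _root_.add_apply, _root_.smul_apply, smul_eq_mul]
    refine Finset.sum_congr rfl fun p _ => ?_
    rw [hw₀, fderiv_radius_apply hα hρ hω]
    ring

end RadialMoment

/-! ### Moments involving quadratic forms, and derivatives of the ellipsoid moments. -/

/-- The trace of an endomorphism of `ℝᵏ`. -/
def clmTrace (B : Vec k →L[ℝ] Vec k) : ℝ :=
  ∑ i, ⟪EuclideanSpace.basisFun (Fin k) ℝ i, B (EuclideanSpace.basisFun (Fin k) ℝ i)⟫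

/-- Splits a quadratic form into products of linear functionals, to which the polarized moments
apply. -/
theorem quadratic_expand (B : Vec k →L[ℝ] Vec k) (ω : Vec k) :
    ⟪ω, B ω⟫ = ∑ i, ⟪EuclideanSpace.basisFun (Fin k) ℝ i, ω⟫ *
      ⟪ContinuousLinearMap.adjoint B (EuclideanSpace.basisFun (Fin k) ℝ i), ω⟫ := by
  rw [← (EuclideanSpace.basisFun (Fin k) ℝ).sum_inner_mul_inner]
  refine Finset.sum_congr rfl fun i _ => ?_
  rw [ContinuousLinearMap.adjoint_inner_left, real_inner_comm]

theorem sphere_moment_quadratic (hk : 1 ≤ k) (B : Vec k →L[ℝ] Vec k) :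
    ∫ ω, ⟪(ω : Vec k), B ω⟫ ∂(sphereMeas k) = (sphereMeas k).real univ / k * clmTrace B := by
  simp_rw [quadratic_expand B]
  rw [integral_finsetSum _ fun i _ => integrable_sphere (q := fun ω =>
    ⟪EuclideanSpace.basisFun (Fin k) ℝ i, ω⟫ *
      ⟪ContinuousLinearMap.adjoint B (EuclideanSpace.basisFun (Fin k) ℝ i), ω⟫) (by fun_prop)]
  simp_rw [sphere_moment_two hk, ContinuousLinearMap.adjoint_inner_right]
  rw [← Finset.mul_sum, clmTrace]
  simp_rw [real_inner_comm]

theorem sphere_moment_bilinear (hk : 1 ≤ k) (x y : Vec k) (B : Vec k →L[ℝ] Vec k) :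
    ∫ ω, ⟪x, B ω⟫ * ⟪y, ω⟫ ∂(sphereMeas k) = (sphereMeas k).real univ / k * ⟪x, B y⟫ := by
  simp_rw [← ContinuousLinearMap.adjoint_inner_left B]
  rw [sphere_moment_two hk]

theorem sphere_moment_four_quadratic (hk : 1 ≤ k) (x y : Vec k) (B : Vec k →L[ℝ] Vec k) :
    ∫ ω, ⟪x, ω⟫ * ⟪y, ω⟫ * ⟪(ω : Vec k), B ω⟫ ∂(sphereMeas k) =
      (sphereMeas k).real univ / (k * (k + 2)) *
        (⟪x, y⟫ * clmTrace B + ⟪x, B y⟫ + ⟪y, B x⟫) := by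
  simp_rw [quadratic_expand B, Finset.mul_sum]
  rw [integral_finsetSum _ fun i _ => integrable_sphere (q := fun ω => ⟪x, ω⟫ * ⟪y, ω⟫ *
    (⟪EuclideanSpace.basisFun (Fin k) ℝ i, ω⟫ *
      ⟪ContinuousLinearMap.adjoint B (EuclideanSpace.basisFun (Fin k) ℝ i), ω⟫)) (by fun_prop)]
  simp_rw [sphere_moment_four hk, ContinuousLinearMap.adjoint_inner_right]
  rw [← Finset.mul_sum, Finset.sum_add_distrib, Finset.sum_add_distrib, ← Finset.mul_sum]
  have h1 : ∑ i, ⟪x, EuclideanSpace.basisFun (Fin k) ℝ i⟫ *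
      ⟪B y, EuclideanSpace.basisFun (Fin k) ℝ i⟫ = ⟪x, B y⟫ := by
    rw [← (EuclideanSpace.basisFun (Fin k) ℝ).sum_inner_mul_inner]
    simp_rw [real_inner_comm]
  have h2 : ∑ i, ⟪B x, EuclideanSpace.basisFun (Fin k) ℝ i⟫ *
      ⟪y, EuclideanSpace.basisFun (Fin k) ℝ i⟫ = ⟪y, B x⟫ := by
    rw [← (EuclideanSpace.basisFun (Fin k) ℝ).sum_inner_mul_inner]
    refine Finset.sum_congr rfl fun i _ => ?_
    rw [mul_comm, real_inner_comm (B x)]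
  rw [h1, h2, clmTrace]
  simp_rw [real_inner_comm]

section Derivatives

variable {g : ℝ → ℝ} {M α ρ : ℝ}

/-- Derivative at a ball of the mass of ellipsoids. -/
theorem hasFDerivAt_mass (hk : 1 ≤ k) (hα : 0 < α) (hρ : 0 < ρ)
    (hg : Measurable g) (hM : ∀ u, |g u| ≤ M)
    (hgi : Integrable (fun y : Vec k => g ‖y‖)) (hgc : ContinuousAt g (α * ρ)) :
    ∃ L : EllParam k →L[ℝ] ℝ,
      HasFDerivAt (fun w : EllParam k => ∫ y in {y | ‖w.2.1 y - w.1‖ ≤ w.2.2}, g ‖y‖) L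
        (ballParam k α ρ) ∧
      ∀ v, L v = (sphereMeas k).real univ * (g (α * ρ) * (α * ρ) ^ (k - 1)) * α *
        (v.2.2 - α * ρ / k * clmTrace v.2.1) := by
  obtain ⟨L, hL, hLv⟩ := hasFDerivAt_integral_ellipsoid hk hα hρ hg hM hgi hgc
    (φ := fun _ => 1) continuous_const 1 (c := fun _ _ _ => 1) (fun _ => contDiff_const)
    (by simp)
  refine ⟨L, by simpa using hL, fun v => ?_⟩
  have hk0 : (0 : ℝ) < k := by exact_mod_cast hk
  set κ := g (α * ρ) * (α * ρ) ^ (k - 1) with hκ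
  rw [hLv v]
  have h1 : ∀ ω : sphere (0 : Vec k) 1, (∑ p ∈ Finset.range 1,
      (fderiv ℝ (fun _ : EllParam k => (1 : ℝ)) (ballParam k α ρ) v * radialMoment k g p (α * ρ) +
        1 * (g (α * ρ) * (α * ρ) ^ (k - 1 + p) *
          (α * v.2.2 + α * ⟪(ω : Vec k), v.1⟫ - α * (α * ρ) * ⟪(ω : Vec k), v.2.1 ω⟫))))
      = (κ * α * v.2.2 - κ * α * (α * ρ) * ⟪(ω : Vec k), v.2.1 ω⟫) +
        κ * α * ⟪v.1, (ω : Vec k)⟫ := by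
    intro ω
    rw [Finset.sum_range_one, fderiv_const_apply, real_inner_comm v.1, add_zero, ← hκ]
    simp only [_root_.zero_apply]
    ring
  simp_rw [h1]
  rw [integral_add
      (integrable_sphere (q := fun ω => κ * α * v.2.2 - κ * α * (α * ρ) * ⟪ω, v.2.1 ω⟫)
        (by fun_prop))
      (integrable_sphere (q := fun ω => κ * α * ⟪v.1, ω⟫) (by fun_prop)),
    integral_sub (integrable_const _)
      (integrable_sphere (q := fun ω => κ * α * (α * ρ) * ⟪ω, v.2.1 ω⟫) (by fun_prop)),
    integral_sphere_odd hk 1 (q := fun ω => κ * α * ⟪v.1, ω⟫) (by fun_prop)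
      (fun t _ x => by rw [inner_smul_right]; ring) (fun x => by rw [inner_neg_right]; ring)]
  simp only [integral_const_mul, sphere_moment_quadratic hk, integral_const, smul_eq_mul]
  ring

/-- Derivative at a ball of the first moments of ellipsoids. -/
theorem hasFDerivAt_first_moment (hk : 1 ≤ k) (hα : 0 < α) (hρ : 0 < ρ)
    (hg : Measurable g) (hM : ∀ u, |g u| ≤ M)
    (hgi : Integrable (fun y : Vec k => g ‖y‖)) (hgc : ContinuousAt g (α * ρ)) (x : Vec k) :
    ∃ L : EllParam k →L[ℝ] ℝ,
      HasFDerivAt (fun w : EllParam k =>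
        ∫ y in {y | ‖w.2.1 y - w.1‖ ≤ w.2.2}, ⟪x, w.2.1 y - w.1⟫ * g ‖y‖) L (ballParam k α ρ) ∧
      ∀ v, L v = (sphereMeas k).real univ *
        (g (α * ρ) * (α * ρ) ^ (k - 1) * (α * ρ) / k - radialMoment k g 0 (α * ρ)) * ⟪x, v.1⟫ := by
  set w₀ := ballParam k α ρ with hw₀
  -- Coefficients in t of ⟪x, t N ω - n⟫; the constant one vanishes at the ball.
  let c : ℕ → EllParam k → Vec k → ℝ := fun p w ω =>
    if p = 0 then -⟪x, w.1⟫ else ⟪x, w.2.1 ω⟫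
  have hc : ∀ p, ContDiff ℝ 2 (fun z : EllParam k × Vec k => c p z.1 z.2) := by
    intro p
    by_cases hp : p = 0
    · simp only [c, hp, if_true]
      exact (contDiff_const.inner ℝ (contDiff_fst.comp contDiff_fst)).neg
    · simp only [c, hp, if_false]
      exact contDiff_const.inner ℝ (by fun_prop)
  obtain ⟨L, hL, hLv⟩ := hasFDerivAt_integral_ellipsoid hk hα hρ hg hM hgi hgc
    (φ := fun z => ⟪x, z⟫) (by fun_prop) 2 hc (fun w ω t => by
      simp [c, Finset.sum_range_succ, inner_sub_right, inner_smul_right]; ring)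
  refine ⟨L, hL, fun v => ?_⟩
  have hk0 : (0 : ℝ) < k := by exact_mod_cast hk
  set κ := g (α * ρ) * (α * ρ) ^ (k - 1) with hκ
  have hd0 : ∀ ω : Vec k, fderiv ℝ (fun w => c 0 w ω) w₀ v = -⟪x, v.1⟫ := by
    intro ω
    let ev : EllParam k →L[ℝ] ℝ :=
      -((innerSL ℝ x) ∘L (ContinuousLinearMap.fst ℝ (Vec k) ((Vec k →L[ℝ] Vec k) × ℝ)))
    have : HasFDerivAt (fun w => c 0 w ω) ev w₀ := ev.hasFDerivAt
    rw [this.fderiv]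
    rfl
  have hd1 : ∀ ω : Vec k, fderiv ℝ (fun w => c 1 w ω) w₀ v = ⟪x, v.2.1 ω⟫ := by
    intro ω
    let ev : EllParam k →L[ℝ] ℝ := (innerSL ℝ x) ∘L (ContinuousLinearMap.apply ℝ (Vec k) ω) ∘L
      (ContinuousLinearMap.fst ℝ _ _ ∘L ContinuousLinearMap.snd ℝ _ _)
    have : HasFDerivAt (fun w => c 1 w ω) ev w₀ := ev.hasFDerivAt
    rw [this.fderiv]
    rfl
  rw [hLv v, ← hw₀]
  -- Collects the terms odd in ω. The factor ‖ω‖², equal to 1 on the sphere, makes them all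
  -- homogeneous of degree 3, as `integral_sphere_odd` requires.
  let odd : Vec k → ℝ := fun ω => (radialMoment k g 1 (α * ρ) * ⟪x, v.2.1 ω⟫ +
    κ * (α * ρ) * v.2.2 * ⟪x, ω⟫) * ‖ω‖ ^ 2 - κ * (α * ρ) ^ 2 * ⟪x, ω⟫ * ⟪ω, v.2.1 ω⟫
  have hodd : Continuous odd := by fun_prop
  have h1 : ∀ ω : sphere (0 : Vec k) 1, (∑ p ∈ Finset.range 2,
      (fderiv ℝ (fun w => c p w ω) w₀ v * radialMoment k g p (α * ρ) +
        c p w₀ ω * (g (α * ρ) * (α * ρ) ^ (k - 1 + p) *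
          (α * v.2.2 + α * ⟪(ω : Vec k), v.1⟫ - α * (α * ρ) * ⟪(ω : Vec k), v.2.1 ω⟫))))
      = (-⟪x, v.1⟫ * radialMoment k g 0 (α * ρ) + κ * (α * ρ) * (⟪x, (ω : Vec k)⟫ * ⟪v.1, (ω : Vec k)⟫))
        + odd ω := by
    intro ω
    have hω : ‖(ω : Vec k)‖ = 1 := by simp
    have e0 : c 0 w₀ ω = 0 := by simp [c, hw₀, ballParam]
    have e1 : c 1 w₀ ω = α⁻¹ * ⟪x, (ω : Vec k)⟫ := by
      simp [c, hw₀, ballParam, inner_smul_right]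
    rw [Finset.sum_range_succ, Finset.sum_range_one, hd0, hd1, e0, e1,
      real_inner_comm v.1 (ω : Vec k), pow_add _ _ 1, ← mul_assoc (g _) _ ((α * ρ) ^ 1), ← hκ]
    simp only [odd, hω]
    field_simp
    ring
  simp_rw [h1]
  rw [integral_add
      (integrable_sphere (q := fun ω => -⟪x, v.1⟫ * radialMoment k g 0 (α * ρ) +
        κ * (α * ρ) * (⟪x, ω⟫ * ⟪v.1, ω⟫)) (by fun_prop)) (integrable_sphere hodd),
    integral_add (integrable_const _)
      (integrable_sphere (q := fun ω => κ * (α * ρ) * (⟪x, ω⟫ * ⟪v.1, ω⟫)) (by fun_prop)),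
    integral_sphere_odd hk 3 hodd
      (fun t _ x => by
        simp only [odd, inner_smul_right, real_inner_smul_left, map_smul, norm_smul, mul_pow,
          Real.norm_eq_abs, sq_abs]; ring)
      (fun x => by simp only [odd, inner_neg_right, inner_neg_left, map_neg, norm_neg]; ring)]
  simp only [integral_const_mul, sphere_moment_two hk, integral_const, smul_eq_mul]
  ring

/-- Derivative at a ball of the second moments of ellipsoids. -/
theorem hasFDerivAt_second_moment (hk : 1 ≤ k) (hα : 0 < α) (hρ : 0 < ρ)
    (hg : Measurable g) (hM : ∀ u, |g u| ≤ M)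
    (hgi : Integrable (fun y : Vec k => g ‖y‖)) (hgc : ContinuousAt g (α * ρ)) (x y : Vec k) :
    ∃ L : EllParam k →L[ℝ] ℝ,
      HasFDerivAt (fun w : EllParam k => ∫ z in {z | ‖w.2.1 z - w.1‖ ≤ w.2.2},
        ⟪x, w.2.1 z - w.1⟫ * ⟪y, w.2.1 z - w.1⟫ * g ‖z‖) L (ballParam k α ρ) ∧
      ∀ v, L v = (sphereMeas k).real univ / k *
          (radialMoment k g 2 (α * ρ) / α * (⟪x, v.2.1 y⟫ + ⟪y, v.2.1 x⟫)
          + g (α * ρ) * (α * ρ) ^ (k - 1) * ρ ^ 2 * α * (⟪x, y⟫ * v.2.2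
            - α * ρ / (k + 2) * (⟪x, y⟫ * clmTrace v.2.1 + ⟪x, v.2.1 y⟫ + ⟪y, v.2.1 x⟫))) := by
  set w₀ := ballParam k α ρ with hw₀
  -- Coefficients in t of ⟪x, t N ω - n⟫ ⟪y, t N ω - n⟫. At the ball those of degree 0 and 1 vanish;
  -- the derivative of the first is also zero and that of the second is odd in ω.
  let c : ℕ → EllParam k → Vec k → ℝ := fun p w ω =>
    if p = 0 then ⟪x, w.1⟫ * ⟪y, w.1⟫
    else if p = 1 then -(⟪x, w.1⟫ * ⟪y, w.2.1 ω⟫ + ⟪x, w.2.1 ω⟫ * ⟪y, w.1⟫)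
    else ⟪x, w.2.1 ω⟫ * ⟪y, w.2.1 ω⟫
  have hN : ∀ x : Vec k, ContDiff ℝ 2 (fun z : EllParam k × Vec k => ⟪x, z.1.2.1 z.2⟫) :=
    fun x => contDiff_const.inner ℝ (by fun_prop)
  have hn : ∀ x : Vec k, ContDiff ℝ 2 (fun z : EllParam k × Vec k => ⟪x, z.1.1⟫) :=
    fun x => contDiff_const.inner ℝ (contDiff_fst.comp contDiff_fst)
  have hc : ∀ p, ContDiff ℝ 2 (fun z : EllParam k × Vec k => c p z.1 z.2) := by
    intro p
    by_cases hp : p = 0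
    · simp only [c, hp, if_true]
      exact (hn x).mul (hn y)
    · by_cases hp1 : p = 1
      · simp only [c, hp1, one_ne_zero, if_true, if_false]
        exact (((hn x).mul (hN y)).add ((hN x).mul (hn y))).neg
      · simp only [c, hp, hp1, if_false]
        exact (hN x).mul (hN y)
  obtain ⟨L, hL, hLv⟩ := hasFDerivAt_integral_ellipsoid hk hα hρ hg hM hgi hgc
    (φ := fun z => ⟪x, z⟫ * ⟪y, z⟫) (by fun_prop) 3 hc (fun w ω t => by
      simp [c, Finset.sum_range_succ, inner_sub_right, inner_smul_right]; ring)
  refine ⟨L, hL, fun v => ?_⟩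
  have hk0 : (0 : ℝ) < k := by exact_mod_cast hk
  set κ := g (α * ρ) * (α * ρ) ^ (k - 1) with hκ
  have hnd : ∀ x : Vec k, HasFDerivAt (fun w : EllParam k => ⟪x, w.1⟫)
      (innerSL ℝ x ∘L ContinuousLinearMap.fst ℝ _ _ : EllParam k →L[ℝ] ℝ) w₀ :=
    fun x => (innerSL ℝ x ∘L ContinuousLinearMap.fst ℝ _ _ : EllParam k →L[ℝ] ℝ).hasFDerivAt
  let ev : Vec k → Vec k → EllParam k →L[ℝ] ℝ := fun x ω =>
    (innerSL ℝ x) ∘L (ContinuousLinearMap.apply ℝ (Vec k) ω) ∘L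
      (ContinuousLinearMap.fst ℝ _ _ ∘L ContinuousLinearMap.snd ℝ _ _)
  have hNd : ∀ x ω : Vec k, HasFDerivAt (fun w : EllParam k => ⟪x, w.2.1 ω⟫) (ev x ω) w₀ :=
    fun x ω => (ev x ω).hasFDerivAt
  have hev : ∀ x ω : Vec k, ev x ω v = ⟪x, v.2.1 ω⟫ := fun _ _ => rfl
  have hd0 : ∀ ω : Vec k, fderiv ℝ (fun w => c 0 w ω) w₀ v = 0 := by
    intro ω
    have : HasFDerivAt (fun w => c 0 w ω) _ w₀ := (hnd x).mul (hnd y)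
    rw [this.fderiv]
    simp [hw₀, ballParam]
  have hd1 : ∀ ω : Vec k, fderiv ℝ (fun w => c 1 w ω) w₀ v
      = -α⁻¹ * (⟪x, v.1⟫ * ⟪y, ω⟫ + ⟪x, ω⟫ * ⟪y, v.1⟫) := by
    intro ω
    have : HasFDerivAt (fun w => c 1 w ω) _ w₀ :=
      (((hnd x).mul (hNd y ω)).add ((hNd x ω).mul (hnd y))).neg
    rw [this.fderiv]
    simp [hw₀, ballParam, inner_smul_right]
    ring
  have hd2 : ∀ ω : Vec k, fderiv ℝ (fun w => c 2 w ω) w₀ v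
      = α⁻¹ * (⟪x, v.2.1 ω⟫ * ⟪y, ω⟫ + ⟪y, v.2.1 ω⟫ * ⟪x, ω⟫) := by
    intro ω
    have : HasFDerivAt (fun w => c 2 w ω) _ w₀ := (hNd x ω).mul (hNd y ω)
    rw [this.fderiv]
    simp [hw₀, ballParam, inner_smul_right, hev]
    ring
  rw [hLv v, ← hw₀]
  -- Again ‖ω‖² = 1 raises the linear terms to degree 3.
  let odd : Vec k → ℝ := fun ω => -α⁻¹ * radialMoment k g 1 (α * ρ) *
    (⟪x, v.1⟫ * ⟪y, ω⟫ + ⟪x, ω⟫ * ⟪y, v.1⟫) * ‖ω‖ ^ 2 +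
      κ * ρ ^ 2 * α * (⟪x, ω⟫ * ⟪y, ω⟫ * ⟪v.1, ω⟫)
  have hodd : Continuous odd := by fun_prop
  have h1 : ∀ ω : sphere (0 : Vec k) 1, (∑ p ∈ Finset.range 3,
      (fderiv ℝ (fun w => c p w ω) w₀ v * radialMoment k g p (α * ρ) +
        c p w₀ ω * (g (α * ρ) * (α * ρ) ^ (k - 1 + p) *
          (α * v.2.2 + α * ⟪(ω : Vec k), v.1⟫ - α * (α * ρ) * ⟪(ω : Vec k), v.2.1 ω⟫))))
      = ((radialMoment k g 2 (α * ρ) / α * (⟪x, v.2.1 ω⟫ * ⟪y, (ω : Vec k)⟫)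
        + radialMoment k g 2 (α * ρ) / α * (⟪y, v.2.1 ω⟫ * ⟪x, (ω : Vec k)⟫))
        + (κ * ρ ^ 2 * α * v.2.2 * (⟪x, (ω : Vec k)⟫ * ⟪y, (ω : Vec k)⟫)
        - κ * ρ ^ 2 * α * (α * ρ) * (⟪x, (ω : Vec k)⟫ * ⟪y, (ω : Vec k)⟫ * ⟪(ω : Vec k), v.2.1 ω⟫)))
        + odd ω := by
    intro ω
    have hω : ‖(ω : Vec k)‖ = 1 := by simp
    have e0 : c 0 w₀ ω = 0 := by simp [c, hw₀, ballParam]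
    have e1 : c 1 w₀ ω = 0 := by simp [c, hw₀, ballParam]
    have e2 : c 2 w₀ ω = α⁻¹ * α⁻¹ * (⟪x, (ω : Vec k)⟫ * ⟪y, (ω : Vec k)⟫) := by
      simp [c, hw₀, ballParam, inner_smul_right]
      ring
    rw [Finset.sum_range_succ, Finset.sum_range_succ, Finset.sum_range_one, hd0, hd1, hd2, e0, e1,
      e2, real_inner_comm v.1 (ω : Vec k), pow_add _ _ 2, ← mul_assoc (g _) _ ((α * ρ) ^ 2), ← hκ]
    simp only [odd, hω]
    field_simp
    ring
  simp_rw [h1]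
  rw [integral_add
      (integrable_sphere (q := fun ω => (radialMoment k g 2 (α * ρ) / α * (⟪x, v.2.1 ω⟫ * ⟪y, ω⟫)
        + radialMoment k g 2 (α * ρ) / α * (⟪y, v.2.1 ω⟫ * ⟪x, ω⟫))
        + (κ * ρ ^ 2 * α * v.2.2 * (⟪x, ω⟫ * ⟪y, ω⟫)
        - κ * ρ ^ 2 * α * (α * ρ) * (⟪x, ω⟫ * ⟪y, ω⟫ * ⟪ω, v.2.1 ω⟫))) (by fun_prop))
      (integrable_sphere hodd),
    integral_add
      (integrable_sphere (q := fun ω => radialMoment k g 2 (α * ρ) / α * (⟪x, v.2.1 ω⟫ * ⟪y, ω⟫)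
        + radialMoment k g 2 (α * ρ) / α * (⟪y, v.2.1 ω⟫ * ⟪x, ω⟫)) (by fun_prop))
      (integrable_sphere (q := fun ω => κ * ρ ^ 2 * α * v.2.2 * (⟪x, ω⟫ * ⟪y, ω⟫)
        - κ * ρ ^ 2 * α * (α * ρ) * (⟪x, ω⟫ * ⟪y, ω⟫ * ⟪ω, v.2.1 ω⟫)) (by fun_prop)),
    integral_add
      (integrable_sphere (q := fun ω => radialMoment k g 2 (α * ρ) / α * (⟪x, v.2.1 ω⟫ * ⟪y, ω⟫))
        (by fun_prop))
      (integrable_sphere (q := fun ω => radialMoment k g 2 (α * ρ) / α * (⟪y, v.2.1 ω⟫ * ⟪x, ω⟫))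
        (by fun_prop)),
    integral_sub
      (integrable_sphere (q := fun ω => κ * ρ ^ 2 * α * v.2.2 * (⟪x, ω⟫ * ⟪y, ω⟫)) (by fun_prop))
      (integrable_sphere (q := fun ω => κ * ρ ^ 2 * α * (α * ρ) *
        (⟪x, ω⟫ * ⟪y, ω⟫ * ⟪ω, v.2.1 ω⟫)) (by fun_prop)),
    integral_sphere_odd hk 3 hodd
      (fun t _ x => by
        simp only [odd, inner_smul_right, norm_smul, mul_pow, Real.norm_eq_abs, sq_abs]; ring)
      (fun x => by simp only [odd, inner_neg_right, norm_neg]; ring)]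
  simp only [integral_const_mul, sphere_moment_two hk, sphere_moment_bilinear hk,
    sphere_moment_four_quadratic hk]
  field_simp
  ring

end Derivatives

/-! ### Strict radial inequalities and the boundary mass. -/

section Constants

/-- The left side is the integral for the constant profile h(r²). Monotonicity gives ≤ throughout,
and strictness on (0, u), where h(t²) ≥ h(u²) > h(r²). -/
theorem pow_div_lt_integral {h : ℝ → ℝ} (h_anti : AntitoneOn h (Set.Ici 0)) {r : ℝ}
    (hu : ∃ u ∈ Set.Ioo 0 r, h (r ^ 2) < h (u ^ 2)) (m : ℕ)
    (hint : ∀ a b, IntervalIntegrable (fun u => h (u ^ 2) * u ^ m) volume a b) :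
    h (r ^ 2) * (r ^ (m + 1) / (m + 1)) < ∫ u in (0 : ℝ)..r, h (u ^ 2) * u ^ m := by
  obtain ⟨u, ⟨hu0, hur⟩, hlt⟩ := hu
  have hpow : ∀ a b, IntervalIntegrable (fun t : ℝ => h (r ^ 2) * t ^ m) volume a b := fun a b =>
    (intervalIntegral.intervalIntegrable_pow m).const_mul _
  have hI : ∀ a b, IntervalIntegrable (fun t : ℝ => h (t ^ 2) * t ^ m - h (r ^ 2) * t ^ m) volume a b :=
    fun a b => (hint a b).sub (hpow a b)
  have hle : ∀ s t : ℝ, 0 ≤ s → s ≤ t → h (t ^ 2) ≤ h (s ^ 2) := fun s t hs hst =>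
    h_anti (by simp; positivity) (by simp; positivity) (by gcongr)
  have h1 : 0 < ∫ t in (0 : ℝ)..u, (h (t ^ 2) * t ^ m - h (r ^ 2) * t ^ m) := by
    refine intervalIntegral.intervalIntegral_pos_of_pos_on (hI _ _) (fun t ht => ?_) hu0
    have := hle t u ht.1.le ht.2.le
    have h3 : 0 < t ^ m := pow_pos ht.1 m
    rw [← sub_mul]
    exact mul_pos (by linarith) h3
  have h2 : 0 ≤ ∫ t in u..r, (h (t ^ 2) * t ^ m - h (r ^ 2) * t ^ m) := by
    refine intervalIntegral.integral_nonneg hur.le fun t ht => ?_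
    have ht0 : 0 ≤ t := hu0.le.trans ht.1
    have := hle t r ht0 ht.2
    rw [← sub_mul]
    exact mul_nonneg (by linarith) (by positivity)
  have h3 := intervalIntegral.integral_add_adjacent_intervals (hI 0 u) (hI u r)
  rw [intervalIntegral.integral_sub (hint 0 r) (hpow 0 r), intervalIntegral.integral_const_mul,
    integral_pow] at h3
  have : (0 : ℝ) ^ (m + 1) = 0 := by simp
  rw [this, sub_zero] at h3
  linarith

theorem smul_idSym_coe (α : ℝ) :
    ((α • idSym k : SymMat k) : Matrix (Fin k) (Fin k) ℝ) = α • (1 : Matrix (Fin k) (Fin k) ℝ) := rfl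

/-- The density is the constant α^k h((αρ)²) on the sphere, and α^k ρ^(k-1) = (αρ)^(k-1) α. -/
theorem boundaryMeasure_sphere (hk : 1 ≤ k) {h : ℝ → ℝ} (h_nonneg : ∀ t, 0 ≤ t → 0 ≤ h t)
    {f : Vec k → ℝ} (hf : ∀ x, f x = h (‖x‖ ^ 2)) {α ρ : ℝ} (hα : 0 < α) (hρ : 0 < ρ) :
    (boundaryMeasure f (0, α • idSym k, ρ)).real (sphere 0 ρ) =
      (sphereMeas k).real univ * h ((α * ρ) ^ 2) * (α * ρ) ^ (k - 1) * α := by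
  have hms : MeasurableSet (sphere (0 : Vec k) ρ) := isClosed_sphere.measurableSet
  have hconst : ∀ ω ∈ sphere (0 : Vec k) ρ,
      ENNReal.ofReal (((α • idSym k : SymMat k) : Matrix (Fin k) (Fin k) ℝ).det *
        f (WithLp.toLp 2 (Matrix.mulVec ((α • idSym k : SymMat k) : Matrix (Fin k) (Fin k) ℝ)
          (WithLp.ofLp ω)) + 0)) = ENNReal.ofReal (α ^ k * h ((α * ρ) ^ 2)) := by
    intro ω hω
    have hω' : ‖ω‖ = ρ := by simpa using hω
    rw [smul_idSym_coe, Matrix.smul_mulVec, Matrix.one_mulVec, WithLp.toLp_smul, WithLp.toLp_ofLp,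
      add_zero, hf, norm_smul, hω', Real.norm_of_nonneg hα.le]
    simp
  have hsurf : surfaceMeasure k ρ (sphere 0 ρ) =
      ENNReal.ofReal (ρ ^ (k - 1)) * sphereMeas k univ := by
    rw [surfaceMeasure, Measure.smul_apply, smul_eq_mul, Measure.map_apply (by fun_prop) hms]
    congr 2
    ext ω
    simp [norm_smul, abs_of_pos hρ]
  have hpow : α ^ k = α ^ (k - 1) * α := by rw [← pow_succ, Nat.sub_add_cancel hk]
  have h0 := h_nonneg ((α * ρ) ^ 2) (by positivity)
  rw [boundaryMeasure, measureReal_def, withDensity_apply _ hms, setLIntegral_congr_fun hms hconst,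
    lintegral_const, Measure.restrict_apply_univ, hsurf, ENNReal.toReal_mul, ENNReal.toReal_mul,
    ENNReal.toReal_ofReal (by positivity), ENNReal.toReal_ofReal (by positivity), hpow,
    measureReal_def]
  ring

theorem ellipsoid_smul_idSym {α ρ : ℝ} (hα : 0 < α) (hρ : 0 < ρ) :
    ellipsoid (0 : Vec k) (((α • idSym k : SymMat k) : Matrix (Fin k) (Fin k) ℝ) ^ 2) ρ =
      closedBall 0 (α * ρ) := by
  have hinv : ((((α • idSym k : SymMat k) : Matrix (Fin k) (Fin k) ℝ)) ^ 2)⁻¹ =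
      (α ^ 2)⁻¹ • (1 : Matrix (Fin k) (Fin k) ℝ) := by
    apply Matrix.inv_eq_right_inv
    rw [smul_idSym_coe, smul_pow, one_pow, smul_mul_smul_comm, one_mul, mul_inv_cancel₀ (by positivity),
      one_smul]
  ext x
  have hx : dotProduct (WithLp.ofLp x) (WithLp.ofLp x) = ‖x‖ ^ 2 := by
    rw [EuclideanSpace.real_norm_sq_eq]
    simp [dotProduct, sq]
  rw [ellipsoid, mem_ofPred_eq, hinv, sub_zero, Matrix.smul_mulVec, Matrix.one_mulVec,
    dotProduct_smul, hx, smul_eq_mul, mem_closedBall, dist_zero_right, inv_mul_le_iff₀ (by positivity),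
    ← mul_pow, sq_le_sq₀ (norm_nonneg _) (by positivity)]

/-- Positivity and continuity of the radial density at the boundary of the ball. -/
theorem ConditionB.radial (hk : 1 ≤ k) {h : ℝ → ℝ} {f : Vec k → ℝ} (hf : ∀ x, f x = h (‖x‖ ^ 2))
    {α ρ : ℝ} (hα : 0 < α) (hρ : 0 < ρ) (hB : ConditionB f (0, α • idSym k, ρ)) :
    0 < h ((α * ρ) ^ 2) ∧ ContinuousAt (fun u => h (u ^ 2)) (α * ρ) := by
  obtain ⟨U, hU, hsub, hcont, hpos⟩ := hB
  have hr : 0 < α * ρ := by positivity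
  rw [ellipsoid_smul_idSym hα hρ, frontier_closedBall _ hr.ne'] at hsub
  obtain ⟨e, he⟩ := exists_unit hk
  have hmem : (α * ρ) • e ∈ U := hsub (by simp [norm_smul, he, abs_of_pos hα, abs_of_pos hρ])
  have hfe : ∀ t : ℝ, f (t • e) = h (t ^ 2) := by
    intro t
    rw [hf, norm_smul, he, mul_one, Real.norm_eq_abs, sq_abs]
  constructor
  · rw [← hfe]; exact hpos _ hmem
  · simp_rw [← hfe]
    exact ContinuousAt.comp (f := fun t : ℝ => t • e) (hcont.continuousAt (hU.mem_nhds hmem))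
      (by fun_prop)

end Constants

/-! ### The change of parameters from (m, G, ρ) to (G⁻¹m, G⁻¹, ρ). -/

section Parametrization

set_option maxSynthPendingDepth 3

attribute [local instance] Matrix.normedAddCommGroup Matrix.normedSpace

/-- A matrix as a continuous endomorphism of `ℝᵏ`. -/
abbrev matCLM : Matrix (Fin k) (Fin k) ℝ ≃⋆ₐ[ℝ] (Vec k →L[ℝ] Vec k) := Matrix.toEuclideanCLM (𝕜 := ℝ)

/-- The ellipsoid parameter of the region determined by `θ`. -/
def toEllParam (θ : Param k) : EllParam k :=
  (matCLM (θ.2.1 : Matrix (Fin k) (Fin k) ℝ)⁻¹ θ.1, matCLM (θ.2.1 : Matrix (Fin k) (Fin k) ℝ)⁻¹, θ.2.2)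

theorem standardize_eq (θ : Param k) (y : Vec k) :
    standardize θ.1 θ.2.1 y = (toEllParam θ).2.1 y - (toEllParam θ).1 := by
  rw [toEllParam, ← map_sub, standardize, ← Matrix.toEuclideanCLM_toLp (𝕜 := ℝ), WithLp.toLp_ofLp]

/-- Both inverses are 0 on singular elements, so no invertibility is needed and `toEllParam` is
expressed globally through `Ring.inverse`. -/
theorem matCLM_inv (A : Matrix (Fin k) (Fin k) ℝ) : matCLM A⁻¹ = Ring.inverse (matCLM A) := by
  rw [Matrix.nonsing_inv_eq_ringInverse]
  by_cases hA : IsUnit A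
  · obtain ⟨u, rfl⟩ := hA
    have := Ring.inverse_unit (Units.map (MonoidHomClass.toMonoidHom (matCLM (k := k))) u)
    rw [Ring.inverse_unit]
    exact this.symm
  · have : ¬ IsUnit (matCLM A) := fun h => hA ((MulEquiv.isUnit_map matCLM).1 h)
    rw [Ring.inverse_non_unit _ hA, Ring.inverse_non_unit _ this, map_zero]

/-- The derivative of `toEllParam` at `(0, α I, ρ)`. -/
def toEllParamDeriv (k : ℕ) (α : ℝ) : Param k →L[ℝ] EllParam k :=
  LinearMap.toContinuousLinearMap
    { toFun := fun v => (α⁻¹ • v.1, -(α ^ 2)⁻¹ • matCLM (v.2.1 : Matrix (Fin k) (Fin k) ℝ), v.2.2)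
      map_add' := fun v w => Prod.ext (smul_add _ _ _) (Prod.ext (by
        change _ • matCLM (_ + _) = _
        rw [map_add, smul_add]
        rfl) rfl)
      map_smul' := fun c v => by simp [smul_comm c] }

theorem toEllParamDeriv_apply (α : ℝ) (v : Param k) : toEllParamDeriv k α v =
    (α⁻¹ • v.1, -(α ^ 2)⁻¹ • matCLM (v.2.1 : Matrix (Fin k) (Fin k) ℝ), v.2.2) := rfl

theorem toEllParam_ball {α : ℝ} (hα : 0 < α) (ρ : ℝ) :
    toEllParam ((0, α • idSym k, ρ) : Param k) = ballParam k α ρ := by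
  have hinv : (((α • idSym k : SymMat k) : Matrix (Fin k) (Fin k) ℝ))⁻¹ =
      α⁻¹ • (1 : Matrix (Fin k) (Fin k) ℝ) := by
    apply Matrix.inv_eq_right_inv
    rw [smul_idSym_coe, smul_mul_smul_comm, one_mul, mul_inv_cancel₀ hα.ne', one_smul]
  simp only [toEllParam, hinv, ballParam, map_zero, map_smul, map_one]
  rfl

/-- Inversion has derivative A ↦ -G⁻¹AG⁻¹, here -α⁻²A. Varying G contributes nothing to G⁻¹m, since
m = 0 at the base point. -/
theorem hasFDerivAt_toEllParam {α : ℝ} (hα : 0 < α) (ρ : ℝ) :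
    HasFDerivAt (toEllParam (k := k)) (toEllParamDeriv k α) (0, α • idSym k, ρ) := by
  set θ₀ : Param k := (0, α • idSym k, ρ) with hθ₀
  let T : Param k →L[ℝ] (Vec k →L[ℝ] Vec k) := LinearMap.toContinuousLinearMap
    { toFun := fun v => matCLM (v.2.1 : Matrix (Fin k) (Fin k) ℝ)
      map_add' := fun v w => by simp
      map_smul' := fun c v => by simp }
  let u : (Vec k →L[ℝ] Vec k)ˣ :=
    ⟨α • 1, α⁻¹ • 1, by ext1 x; simp [smul_smul, hα.ne'],
      by ext1 x; simp [smul_smul, hα.ne']⟩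
  have hTu : T θ₀ = u := by
    change matCLM (α • (1 : Matrix (Fin k) (Fin k) ℝ)) = α • 1
    rw [map_smul, map_one]
  have hR : HasFDerivAt (Ring.inverse : (Vec k →L[ℝ] Vec k) → (Vec k →L[ℝ] Vec k))
      (-ContinuousLinearMap.mulLeftRight ℝ (Vec k →L[ℝ] Vec k) (u⁻¹ : (Vec k →L[ℝ] Vec k)ˣ)
        (u⁻¹ : (Vec k →L[ℝ] Vec k)ˣ)) (T θ₀) := by
    rw [hTu]
    exact hasFDerivAt_ringInverse (𝕜 := ℝ) u
  have hinv : HasFDerivAt (fun θ : Param k => Ring.inverse (T θ)) _ θ₀ :=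
    hR.comp θ₀ T.hasFDerivAt
  have hm : HasFDerivAt (fun θ : Param k => θ.1) (ContinuousLinearMap.fst ℝ _ _) θ₀ := hasFDerivAt_fst
  let pρ : Param k →L[ℝ] ℝ := ContinuousLinearMap.snd ℝ _ _ ∘L ContinuousLinearMap.snd ℝ _ _
  have hρ : HasFDerivAt (fun θ : Param k => θ.2.2) pρ θ₀ := pρ.hasFDerivAt
  have htot := (hinv.clm_apply hm).prodMk (hinv.prodMk hρ)
  have hfun : (toEllParam (k := k)) = fun θ => (Ring.inverse (T θ) θ.1, Ring.inverse (T θ), θ.2.2) := by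
    funext θ
    rw [toEllParam, matCLM_inv]
    rfl
  rw [hfun]
  refine htot.congr_fderiv (ContinuousLinearMap.ext fun v => ?_)
  have hu : Ring.inverse (T θ₀) = α⁻¹ • 1 := by rw [hTu, Ring.inverse_unit]; rfl
  have hui : ((u⁻¹ : (Vec k →L[ℝ] Vec k)ˣ) : Vec k →L[ℝ] Vec k) = α⁻¹ • 1 := rfl
  change (Ring.inverse (T θ₀) v.1 + (-((u⁻¹ : (Vec k →L[ℝ] Vec k)ˣ) * T v *
      (u⁻¹ : (Vec k →L[ℝ] Vec k)ˣ) : Vec k →L[ℝ] Vec k)) (0 : Vec k),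
    -((u⁻¹ : (Vec k →L[ℝ] Vec k)ˣ) * T v * (u⁻¹ : (Vec k →L[ℝ] Vec k)ˣ) : Vec k →L[ℝ] Vec k),
    v.2.2) = (α⁻¹ • v.1, -(α ^ 2)⁻¹ • T v, v.2.2)
  rw [hu, hui, map_zero, add_zero]
  refine Prod.ext rfl (Prod.ext ?_ rfl)
  change -(α⁻¹ • 1 * T v * α⁻¹ • 1) = _
  ext1 x
  simp [smul_smul, sq]

end Parametrization

/-! ### The components of Λ as ellipsoid integrals. -/

theorem inner_single_matCLM (A : Matrix (Fin k) (Fin k) ℝ) (i j : Fin k) :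
    ⟪EuclideanSpace.single i (1 : ℝ), matCLM A (EuclideanSpace.single j (1 : ℝ))⟫ = A i j := by
  rw [EuclideanSpace.inner_single_left, Matrix.ofLp_toEuclideanCLM]
  simp

theorem clmTrace_matCLM (A : SymMat k) : clmTrace (matCLM (A : Matrix (Fin k) (Fin k) ℝ)) = tr A := by
  simp only [clmTrace, EuclideanSpace.basisFun_apply, inner_single_matCLM]
  rfl

theorem clmTrace_smul (c : ℝ) (B : Vec k →L[ℝ] Vec k) : clmTrace (c • B) = c * clmTrace B := by
  simp only [clmTrace, Finset.mul_sum]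
  exact Finset.sum_congr rfl fun i _ => inner_smul_right _ _ _

theorem region_eq (θ : Param k) :
    region θ = {y | ‖(toEllParam θ).2.1 y - (toEllParam θ).1‖ ≤ (toEllParam θ).2.2} := by
  ext y
  rw [region, mem_ofPred_eq, standardize_eq]
  rfl

theorem continuous_standardize (θ : Param k) : Continuous (standardize θ.1 θ.2.1) := by
  rw [funext (standardize_eq θ)]
  fun_prop

theorem measurableSet_region (θ : Param k) : MeasurableSet (region θ) :=
  (isClosed_le (continuous_standardize θ).norm continuous_const).measurableSet

/-- On the region the standardized variable stays in a compact ball, where φ is bounded. -/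
theorem integrable_indicator_region {E : Type*} [NormedAddCommGroup E]
    [SecondCountableTopologyEither (Vec k) E] (P : Measure (Vec k))
    [IsFiniteMeasure P] {φ : Vec k → E} (hφ : Continuous φ) (θ : Param k) :
    Integrable (fun y => (region θ).indicator (fun y => φ (standardize θ.1 θ.2.1 y)) y) P := by
  obtain ⟨C, hC⟩ := (isCompact_closedBall (0 : Vec k) θ.2.2).exists_bound_of_continuousOn
    hφ.continuousOn
  have h : IntegrableOn (fun y => φ (standardize θ.1 θ.2.1 y)) (region θ) P := by
    refine Measure.integrableOn_of_bounded (M := C) (measure_ne_top _ _)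
      (hφ.comp (continuous_standardize θ)).aestronglyMeasurable ?_
    filter_upwards [ae_restrict_mem (measurableSet_region θ)] with y hy
    exact hC _ (by simpa [region] using hy)
  exact h.integrable_indicator (measurableSet_region θ)

theorem single_inner (x : Vec k) (i : Fin k) : ⟪EuclideanSpace.single i (1 : ℝ), x⟫ = x i := by
  simp [EuclideanSpace.inner_single_left]

section Components

variable {g : ℝ → ℝ} {P : Measure (Vec k)}

theorem integral_indicator_region (hg : Measurable g) (hg0 : ∀ u, 0 ≤ g u)
    (hP : P = volume.withDensity fun x => ENNReal.ofReal (g ‖x‖)) (φ : Vec k → ℝ) (θ : Param k) :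
    ∫ y, (region θ).indicator (fun y => φ (standardize θ.1 θ.2.1 y)) y ∂P =
      ∫ y in {y | ‖(toEllParam θ).2.1 y - (toEllParam θ).1‖ ≤ (toEllParam θ).2.2},
        φ ((toEllParam θ).2.1 y - (toEllParam θ).1) * g ‖y‖ := by
  rw [integral_indicator (measurableSet_region θ), ← region_eq, hP,
    setIntegral_withDensity_eq_setIntegral_toReal_smul (by fun_prop)
      (.of_forall fun _ => ENNReal.ofReal_lt_top) _ (measurableSet_region θ)]
  refine integral_congr_ae (.of_forall fun y => ?_)
  simp only [ENNReal.toReal_ofReal (hg0 _), smul_eq_mul, standardize_eq]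
  ring

variable [IsProbabilityMeasure P]

theorem integrable_radial_density (hg : Measurable g) (hg0 : ∀ u, 0 ≤ g u)
    (hP : P = volume.withDensity fun x => ENNReal.ofReal (g ‖x‖)) :
    Integrable fun y : Vec k => g ‖y‖ := by
  refine ⟨(hg.comp measurable_norm).aestronglyMeasurable, ?_⟩
  rw [hasFiniteIntegral_iff_ofReal (.of_forall fun _ => hg0 _)]
  have : P univ = 1 := measure_univ
  rw [hP, withDensity_apply _ MeasurableSet.univ, Measure.restrict_univ] at this
  simp [this]

theorem Lambda1_apply (hg : Measurable g) (hg0 : ∀ u, 0 ≤ g u)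
    (hP : P = volume.withDensity fun x => ENNReal.ofReal (g ‖x‖)) (θ : Param k) (i : Fin k) :
    Lambda1 P θ i =
      ∫ y in {y | ‖(toEllParam θ).2.1 y - (toEllParam θ).1‖ ≤ (toEllParam θ).2.2},
        ⟪EuclideanSpace.single i (1 : ℝ), (toEllParam θ).2.1 y - (toEllParam θ).1⟫ * g ‖y‖ := by
  rw [← integral_indicator_region hg hg0 hP fun z => ⟪EuclideanSpace.single i (1 : ℝ), z⟫]
  have h1 : Integrable (fun y => Psi1 y θ) P :=
    integrable_indicator_region P (φ := fun z => z) continuous_id θ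
  have h2 := (innerSL ℝ (EuclideanSpace.single i (1 : ℝ))).integral_comp_comm h1
  rw [← single_inner, Lambda1]
  refine h2.symm.trans (integral_congr_ae (.of_forall fun y => ?_))
  by_cases hy : y ∈ region θ <;> simp [Psi1, hy]

theorem Lambda2_apply (hg : Measurable g) (hg0 : ∀ u, 0 ≤ g u)
    (hP : P = volume.withDensity fun x => ENNReal.ofReal (g ‖x‖)) (θ : Param k) (i j : Fin k) :
    (Lambda2 P θ : Matrix (Fin k) (Fin k) ℝ) i j =
      (∫ y in {y | ‖(toEllParam θ).2.1 y - (toEllParam θ).1‖ ≤ (toEllParam θ).2.2},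
        ⟪EuclideanSpace.single i (1 : ℝ), (toEllParam θ).2.1 y - (toEllParam θ).1⟫ *
        ⟪EuclideanSpace.single j (1 : ℝ), (toEllParam θ).2.1 y - (toEllParam θ).1⟫ * g ‖y‖) -
      (1 : Matrix (Fin k) (Fin k) ℝ) i j *
        ∫ y in {y | ‖(toEllParam θ).2.1 y - (toEllParam θ).1‖ ≤ (toEllParam θ).2.2}, g ‖y‖ := by
  have e1 := integral_indicator_region hg hg0 hP
    (fun z => ⟪EuclideanSpace.single i (1 : ℝ), z⟫ * ⟪EuclideanSpace.single j (1 : ℝ), z⟫) θ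
  have e2 := integral_indicator_region hg hg0 hP (fun _ => 1) θ
  simp only [one_mul] at e2
  rw [← e1, ← e2, ← integral_const_mul, ← integral_sub
    (integrable_indicator_region P (φ := fun z => ⟪EuclideanSpace.single i (1 : ℝ), z⟫ *
      ⟪EuclideanSpace.single j (1 : ℝ), z⟫) (by fun_prop) θ)
    ((integrable_indicator_region P (φ := fun _ => (1 : ℝ)) continuous_const θ).const_mul _)]
  refine integral_congr_ae (.of_forall fun y => ?_)
  have hG : ((θ.2.1 : Matrix (Fin k) (Fin k) ℝ)⁻¹).transpose = (θ.2.1 : Matrix (Fin k) (Fin k) ℝ)⁻¹ := by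
    rw [Matrix.transpose_nonsing_inv, show (θ.2.1 : Matrix (Fin k) (Fin k) ℝ).transpose = θ.2.1
      from θ.2.1.2]
  by_cases hy : y ∈ region θ
  · simp only [Psi2, indicator_of_mem hy, single_inner]
    -- Symmetry of G⁻¹ turns G⁻¹(y-m)(y-m)'G⁻¹ into the outer square of the standardized vector.
    rw [Matrix.mul_vecMulVec, Matrix.vecMulVec_mul, ← Matrix.mulVec_transpose, hG]
    simp [Matrix.vecMulVec_apply, standardize]
  · simp [Psi2, hy]

theorem Lambda3_eq (hg : Measurable g) (hg0 : ∀ u, 0 ≤ g u)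
    (hP : P = volume.withDensity fun x => ENNReal.ofReal (g ‖x‖)) (γ : ℝ) (θ : Param k) :
    Lambda3 γ P θ =
      (∫ y in {y | ‖(toEllParam θ).2.1 y - (toEllParam θ).1‖ ≤ (toEllParam θ).2.2}, g ‖y‖) - γ := by
  have e2 := integral_indicator_region hg hg0 hP (fun _ => 1) θ
  simp only [one_mul] at e2
  rw [← e2, Lambda3]
  simp only [Psi3]
  rw [integral_sub (integrable_indicator_region P (φ := fun _ => (1 : ℝ)) continuous_const θ)
    (integrable_const _), integral_const]
  simp

end Components

/-! ### The derivative of Λ. -/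

section Derivative

set_option maxSynthPendingDepth 3

attribute [local instance] Matrix.normedAddCommGroup Matrix.normedSpace

/-- Projection of a matrix onto its symmetric part. -/
def symmPart (k : ℕ) : Matrix (Fin k) (Fin k) ℝ →L[ℝ] SymMat k :=
  LinearMap.toContinuousLinearMap
    { toFun := fun A => ⟨(2 : ℝ)⁻¹ • (A + A.transpose), by
        change Matrix.IsSymm _
        rw [Matrix.IsSymm, Matrix.transpose_smul, Matrix.transpose_add, Matrix.transpose_transpose,
          add_comm]⟩
      map_add' := fun A B => Subtype.ext (by
        change (2 : ℝ)⁻¹ • (A + B + (A + B).transpose) = (2 : ℝ)⁻¹ • (A + A.transpose) +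
          (2 : ℝ)⁻¹ • (B + B.transpose)
        rw [Matrix.transpose_add, ← smul_add]
        congr 1
        abel)
      map_smul' := fun c A => Subtype.ext (by
        change (2 : ℝ)⁻¹ • (c • A + (c • A).transpose) = c • (2 : ℝ)⁻¹ • (A + A.transpose)
        rw [Matrix.transpose_smul, ← smul_add, smul_comm]) }

theorem symmPart_coe (A : SymMat k) : symmPart k (A : Matrix (Fin k) (Fin k) ℝ) = A := by
  apply Subtype.ext
  change (2 : ℝ)⁻¹ • ((A : Matrix (Fin k) (Fin k) ℝ) + (A : Matrix (Fin k) (Fin k) ℝ).transpose) = A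
  rw [show (A : Matrix (Fin k) (Fin k) ℝ).transpose = A from A.2, ← two_smul ℝ, smul_smul]
  norm_num

/-- Differentiability of a map into `S(k)` can be checked entrywise. -/
theorem hasFDerivAt_symMat {F : Param k → SymMat k} {F' : Param k →L[ℝ] SymMat k} {θ : Param k}
    (h : ∀ i j, ∃ L : Param k →L[ℝ] ℝ,
      HasFDerivAt (fun θ => (F θ : Matrix (Fin k) (Fin k) ℝ) i j) L θ ∧
      ∀ v, L v = (F' v : Matrix (Fin k) (Fin k) ℝ) i j) : HasFDerivAt F F' θ := by
  let ι : SymMat k →L[ℝ] Matrix (Fin k) (Fin k) ℝ := (SymMat k).subtypeL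
  have h1 : HasFDerivAt (fun θ => (F θ : Matrix (Fin k) (Fin k) ℝ)) (ι ∘L F') θ := by
    refine hasFDerivAt_pi'' fun i => hasFDerivAt_pi'' fun j => ?_
    obtain ⟨L, hL, hLv⟩ := h i j
    exact hL.congr_fderiv (ContinuousLinearMap.ext hLv)
  -- Symmetrization fixes S(k), so composing with it returns the matrix-valued derivative to the
  -- subspace.
  have h2 := (symmPart k).hasFDerivAt.comp θ h1
  have e1 : (symmPart k) ∘ (fun θ => (F θ : Matrix (Fin k) (Fin k) ℝ)) = F :=
    funext fun θ => symmPart_coe _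
  rw [e1] at h2
  exact h2.congr_fderiv (ContinuousLinearMap.ext fun v => symmPart_coe _)

theorem hasFDerivAt_vec {F : Param k → Vec k} {F' : Param k →L[ℝ] Vec k} {θ : Param k}
    (h : ∀ i, ∃ L : Param k →L[ℝ] ℝ, HasFDerivAt (fun θ => F θ i) L θ ∧ ∀ v, L v = F' v i) :
    HasFDerivAt F F' θ := by
  let e := EuclideanSpace.equiv (Fin k) ℝ
  have h1 : HasFDerivAt (e ∘ F) ((e : Vec k →L[ℝ] (Fin k → ℝ)) ∘L F') θ := by
    refine hasFDerivAt_pi'' fun i => ?_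
    obtain ⟨L, hL, hLv⟩ := h i
    exact hL.congr_fderiv (ContinuousLinearMap.ext hLv)
  exact e.comp_hasFDerivAt_iff.1 h1

variable {g : ℝ → ℝ} {M : ℝ} {P : Measure (Vec k)} [IsProbabilityMeasure P]

/-- The derivative of `Λ` at a centred ball, for a radial density. -/
theorem hasFDerivAt_Lambda (hk : 1 ≤ k) {α ρ : ℝ} (hα : 0 < α) (hρ : 0 < ρ)
    (hg : Measurable g) (hg0 : ∀ u, 0 ≤ g u) (hM : ∀ u, g u ≤ M)
    (hP : P = volume.withDensity fun x => ENNReal.ofReal (g ‖x‖))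
    (hgc : ContinuousAt g (α * ρ)) (γ : ℝ) {ν : ℝ}
    (hν : ν = (sphereMeas k).real univ * (g (α * ρ) * (α * ρ) ^ (k - 1)) * α)
    (D : Param k →L[ℝ] Param k)
    (hD1 : ∀ v i, (D v).1 i =
      1 / α * (ρ / k * ν - (sphereMeas k).real univ * radialMoment k g 0 (α * ρ)) * v.1 i)
    (hD2 : ∀ v i j, ((D v).2.1 : Matrix (Fin k) (Fin k) ℝ) i j =
      (2 * ρ ^ 3 * ν / (α * k * (k + 2)) -
        2 * ((sphereMeas k).real univ * radialMoment k g 2 (α * ρ) / (k * α ^ 2)) / α) *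
          (v.2.1 : Matrix (Fin k) (Fin k) ℝ) i j +
      (ρ ^ 3 * ν / (α * k * (k + 2)) - ρ * ν / (k * α)) * tr v.2.1 *
        (1 : Matrix (Fin k) (Fin k) ℝ) i j +
      (ρ ^ 2 / k * ν - ν) * v.2.2 * (1 : Matrix (Fin k) (Fin k) ℝ) i j)
    (hD3 : ∀ v, (D v).2.2 = ρ * ν / (k * α) * tr v.2.1 + ν * v.2.2) :
    HasFDerivAt (Lambda γ P) D (0, α • idSym k, ρ) := by
  have hk0 : (0 : ℝ) < k := by exact_mod_cast hk
  have hM' : ∀ u, |g u| ≤ M := fun u => by rw [abs_of_nonneg (hg0 u)]; exact hM u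
  have hgi := integrable_radial_density hg hg0 hP
  have hq := hasFDerivAt_toEllParam (k := k) hα ρ
  have hq0 := toEllParam_ball (k := k) hα ρ
  set θ₀ : Param k := (0, α • idSym k, ρ)
  obtain ⟨L₀, hL₀, hL₀v⟩ := hasFDerivAt_mass hk hα hρ hg hM' hgi hgc
  rw [← hq0] at hL₀
  have hmass := hL₀.comp θ₀ hq
  -- The minus sign in -α⁻²A cancels the one in the mass derivative: enlarging G enlarges the
  -- ellipsoid.
  have hmassv : ∀ v, L₀ (toEllParamDeriv k α v) = ρ * ν / (k * α) * tr v.2.1 + ν * v.2.2 := by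
    intro v
    rw [hL₀v, toEllParamDeriv_apply, clmTrace_smul, clmTrace_matCLM,
      hν]
    field_simp
    ring
  have h1 : HasFDerivAt (fun θ => (Lambda γ P θ).1) (ContinuousLinearMap.fst ℝ _ _ ∘L D) θ₀ := by
    refine hasFDerivAt_vec fun i => ?_
    obtain ⟨L, hL, hLv⟩ := hasFDerivAt_first_moment hk hα hρ hg hM' hgi hgc
      (EuclideanSpace.single i (1 : ℝ))
    rw [← hq0] at hL
    refine ⟨_, (hL.comp θ₀ hq).congr_of_eventuallyEq
      (.of_forall fun θ => Lambda1_apply hg hg0 hP θ i), fun v => ?_⟩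
    refine Eq.trans ?_ (hD1 v i).symm
    change L (toEllParamDeriv k α v) = _
    rw [hLv, toEllParamDeriv_apply, inner_smul_right, single_inner, hν]
    field_simp
  have h2 : HasFDerivAt (fun θ => (Lambda γ P θ).2.1)
      (ContinuousLinearMap.fst ℝ _ _ ∘L ContinuousLinearMap.snd ℝ _ _ ∘L D) θ₀ := by
    refine hasFDerivAt_symMat fun i j => ?_
    obtain ⟨L, hL, hLv⟩ := hasFDerivAt_second_moment hk hα hρ hg hM' hgi hgc
      (EuclideanSpace.single i (1 : ℝ)) (EuclideanSpace.single j (1 : ℝ))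
    rw [← hq0] at hL
    refine ⟨_, ((hL.comp θ₀ hq).sub (hmass.const_mul ((1 : Matrix (Fin k) (Fin k) ℝ) i j))
      ).congr_of_eventuallyEq (.of_forall fun θ => Lambda2_apply hg hg0 hP θ i j), fun v => ?_⟩
    refine Eq.trans ?_ (hD2 v i j).symm
    have hsymm : (v.2.1 : Matrix (Fin k) (Fin k) ℝ) j i = (v.2.1 : Matrix (Fin k) (Fin k) ℝ) i j :=
      Matrix.IsSymm.apply v.2.1.2 i j
    have hone : ⟪EuclideanSpace.single i (1 : ℝ), (EuclideanSpace.single j (1 : ℝ) : Vec k)⟫ =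
        (1 : Matrix (Fin k) (Fin k) ℝ) i j := by
      rw [single_inner, Matrix.one_apply, PiLp.single_apply]
    change L (toEllParamDeriv k α v) - (1 : Matrix (Fin k) (Fin k) ℝ) i j *
      L₀ (toEllParamDeriv k α v) = _
    rw [hmassv, hLv,
      toEllParamDeriv_apply, clmTrace_smul, clmTrace_matCLM, hone]
    simp only [_root_.smul_apply, inner_smul_right, inner_single_matCLM, hsymm]
    rw [hν]
    field_simp
    ring
  have h3 : HasFDerivAt (fun θ => (Lambda γ P θ).2.2)
      (ContinuousLinearMap.snd ℝ _ _ ∘L ContinuousLinearMap.snd ℝ _ _ ∘L D) θ₀ := by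
    refine ((hmass.sub_const γ).congr_of_eventuallyEq
      (.of_forall fun θ => Lambda3_eq hg hg0 hP γ θ)).congr_fderiv (ContinuousLinearMap.ext fun v => ?_)
    exact (hmassv v).trans (hD3 v).symm
  exact h1.prodMk (h2.prodMk h3)

end Derivative

/-! ### Algebra of the block maps. -/

theorem tr_add (A B : SymMat k) : tr (A + B) = tr A + tr B :=
  Matrix.trace_add (A : Matrix (Fin k) (Fin k) ℝ) B

theorem tr_smul (c : ℝ) (A : SymMat k) : tr (c • A) = c * tr A :=
  Matrix.trace_smul c (A : Matrix (Fin k) (Fin k) ℝ)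

theorem tr_idSym : tr (idSym k) = k := by
  simp [tr, idSym]

/-- The linear maps on `ℝᵏ × S(k) × ℝ` that commute with rotations and have no coupling between the
first and the other components. -/
def blockMap (k : ℕ) (a b c d e f : ℝ) : Param k →ₗ[ℝ] Param k where
  toFun v := (a • v.1, b • v.2.1 + (c * tr v.2.1) • idSym k + (d * v.2.2) • idSym k,
    e * tr v.2.1 + f * v.2.2)
  map_add' v w := by
    refine Prod.ext (smul_add _ _ _) (Prod.ext ?_ ?_)
    · simp only [Prod.snd_add, Prod.fst_add, tr_add]
      module
    · simp only [Prod.snd_add, Prod.fst_add, tr_add]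
      ring
  map_smul' t v := by
    refine Prod.ext (smul_comm _ _ _) (Prod.ext ?_ ?_)
    · simp only [Prod.smul_snd, Prod.smul_fst, tr_smul, RingHom.id_apply, smul_eq_mul]
      module
    · simp only [Prod.smul_snd, Prod.smul_fst, tr_smul, RingHom.id_apply, smul_eq_mul]
      ring

theorem blockMap_apply (a b c d e f : ℝ) (v : Param k) : blockMap k a b c d e f v =
    (a • v.1, b • v.2.1 + (c * tr v.2.1) • idSym k + (d * v.2.2) • idSym k,
      e * tr v.2.1 + f * v.2.2) := rfl

/-- The hypotheses are the coefficients of the composite, with Tr I = k. -/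
theorem blockMap_comp_eq_id {a b c d e f a' b' c' d' e' f' : ℝ} (ha : a * a' = 1) (hb : b * b' = 1)
    (hc : b * c' + c * b' + k * c * c' + d * e' = 0) (hd : b * d' + k * c * d' + d * f' = 0)
    (he : e * (b' + k * c') + f * e' = 0) (hf : e * k * d' + f * f' = 1) :
    blockMap k a b c d e f ∘ₗ blockMap k a' b' c' d' e' f' = LinearMap.id := by
  refine LinearMap.ext fun v => ?_
  rw [LinearMap.comp_apply, blockMap_apply, blockMap_apply, LinearMap.id_apply]
  simp only [tr_add, tr_smul, tr_idSym]
  refine Prod.ext ?_ (Prod.ext ?_ ?_)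
  · simp only [smul_smul, ha, one_smul]
  · have h1 : ∀ (x y : ℝ), x = 1 → y = 0 → x • v.2.1 + y • idSym k = v.2.1 := by
      rintro x y rfl rfl
      rw [one_smul, zero_smul, add_zero]
    refine Eq.trans ?_ (h1 (b * b') ((b * c' + c * b' + k * c * c' + d * e') * tr v.2.1 +
      (b * d' + k * c * d' + d * f') * v.2.2) hb (by rw [hc, hd]; ring))
    module
  · simp only
    linear_combination tr v.2.1 * he + v.2.2 * hf

/-- Radial densities with decreasing profile are measurable. -/
theorem measurable_radial {h : ℝ → ℝ} (h_anti : AntitoneOn h (Set.Ici 0)) :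
    Measurable fun u : ℝ => h (u ^ 2) := by
  -- Freezing h at h(0) on negative arguments gives a globally monotone, hence measurable, function.
  have h1 : Antitone fun t : ℝ => h (max t 0) := fun s t hst =>
    h_anti (by simp) (by simp) (by gcongr)
  have h2 : (fun u : ℝ => h (u ^ 2)) = (fun t : ℝ => h (max t 0)) ∘ fun u => u ^ 2 := by
    funext u
    simp only [Function.comp, max_eq_left (sq_nonneg u)]
  rw [h2]
  exact h1.measurable.comp (by fun_prop)

end MCD
end

/-! ### Assembly: constants, signs, derivative and inverse. -/

theorem theorem4p2 (k : ℕ) (hk : 1 ≤ k) (γ : ℝ) (hγ0 : 0 < γ) (hγ1 : γ ≤ 1)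
    -- a spherically symmetric density `f(x) = h(‖x‖²)`, with `h` decreasing
    (h : ℝ → ℝ) (h_nonneg : ∀ t, 0 ≤ t → 0 ≤ h t) (h_anti : AntitoneOn h (Set.Ici 0))
    (f : MCD.Vec k → ℝ) (hf : ∀ x, f x = h (‖x‖ ^ 2))
    (P : MeasureTheory.Measure (MCD.Vec k)) (hP : MeasureTheory.IsProbabilityMeasure P)
    (hPf : P = MeasureTheory.volume.withDensity fun x => ENNReal.ofReal (f x))
    -- `r = r(γ)` and `α = α(γ)`
    (r : ℝ) (hr0 : 0 < r)
    (hr : 2 * Real.pi ^ ((k : ℝ) / 2) / Real.Gamma ((k : ℝ) / 2) *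
      (∫ u in (0 : ℝ)..r, h (u ^ 2) * u ^ (k - 1)) = γ)
    (α : ℝ) (hα0 : 0 < α)
    (hα : α ^ 2 = 2 * Real.pi ^ ((k : ℝ) / 2) / (γ * k * Real.Gamma ((k : ℝ) / 2)) *
      (∫ u in (0 : ℝ)..r, h (u ^ 2) * u ^ (k + 1)))
    -- unimodality: the density is not constant on the interior of the ball of radius `r`
    (h_unimodal : ∃ u ∈ Set.Ioo 0 r, h (r ^ 2) < h (u ^ 2))
    -- `θ₀ = (0, α I, r / α)`
    (ρ₀ : ℝ) (hρ₀ : ρ₀ = r / α)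
    (θ₀ : MCD.Param k) (hθ₀ : θ₀ = (0, α • MCD.idSym k, ρ₀))
    (hB : MCD.ConditionB f θ₀)
    -- the constants
    (ν₀ β₁ β₂ β₃ β₄ β₅ β₆ : ℝ)
    (hν₀ : ν₀ = (MCD.boundaryMeasure f θ₀).real (Metric.sphere 0 ρ₀))
    (hβ₁ : β₁ = 1 / α * (ρ₀ / k * ν₀ - γ))
    (hβ₂ : β₂ = 2 * ρ₀ ^ 3 * ν₀ / (α * k * (k + 2)) - 2 * γ / α)
    (hβ₃ : β₃ = ρ₀ ^ 3 * ν₀ / (α * k * (k + 2)) - ρ₀ * ν₀ / (k * α))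
    (hβ₄ : β₄ = ρ₀ ^ 2 / k * ν₀ - ν₀)
    (hβ₅ : β₅ = ρ₀ * ν₀ / (k * α))
    (hβ₆ : β₆ = ν₀) :
    ν₀ = 2 * Real.pi ^ ((k : ℝ) / 2) / Real.Gamma ((k : ℝ) / 2) * h (r ^ 2) * r ^ (k - 1) * α ∧
    β₁ < 0 ∧ β₂ < 0 ∧ 0 < β₆ ∧
    ∃ D : MCD.Param k ≃L[ℝ] MCD.Param k,
      HasFDerivAt (MCD.Lambda γ P) (D : MCD.Param k →L[ℝ] MCD.Param k) θ₀ ∧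
      (∀ (η : MCD.Vec k) (A : MCD.SymMat k) (s : ℝ),
        D (η, A, s) =
          (β₁ • η,
            β₂ • A + (β₃ * MCD.tr A) • MCD.idSym k + (β₄ * s) • MCD.idSym k,
            β₅ * MCD.tr A + β₆ * s)) ∧
      (∀ (g : MCD.Vec k) (B : MCD.SymMat k) (t : ℝ),
        D.symm (g, B, t) =
          (β₁⁻¹ • g,
            β₂⁻¹ • B
              + (α * (β₃ * β₆ - β₄ * β₅) / (2 * γ * β₂ * β₆) * MCD.tr B) • MCD.idSym k
              + (α * β₄ / (2 * γ * β₆) * t) • MCD.idSym k,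
            α * β₅ / (2 * γ * β₆) * MCD.tr B
              - α * (β₂ + k * β₃) / (2 * γ * β₆) * t)) := by
  subst hθ₀ hρ₀
  have hk0 : (0 : ℝ) < k := by exact_mod_cast hk
  have hαr : α * (r / α) = r := by field_simp
  have hρ : 0 < r / α := by positivity
  have hg := MCD.measurable_radial h_anti
  have hle : ∀ u : ℝ, h (u ^ 2) ≤ h 0 := fun u => h_anti (by simp) (by simp; positivity) (by positivity)
  have hg0 : ∀ u : ℝ, 0 ≤ h (u ^ 2) := fun u => h_nonneg _ (by positivity)
  have hint : ∀ m a b, IntervalIntegrable (fun u => h (u ^ 2) * u ^ m) MeasureTheory.volume a b :=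
    fun m a b => MCD.intervalIntegrable_mul_pow hg
      (fun u => by rw [abs_of_nonneg (hg0 u)]; exact hle u) m a b
  obtain ⟨hpos, hgc⟩ := hB.radial hk hf hα0 hρ
  rw [hαr] at hpos
  have hσ := MCD.sphereMeas_univ hk
  set σ : ℝ := (MCD.sphereMeas k).real Set.univ with hσdef
  have hΓ : 0 < Real.Gamma ((k : ℝ) / 2) := Real.Gamma_pos_of_pos (by positivity)
  have hσ0 : 0 < σ := by rw [hσ]; positivity
  have hν : ν₀ = σ * h (r ^ 2) * r ^ (k - 1) * α := by
    rw [hν₀, MCD.boundaryMeasure_sphere hk h_nonneg hf hα0 hρ, hαr]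
  have hJ0 : σ * MCD.radialMoment k (fun u => h (u ^ 2)) 0 r = γ := by
    rw [hσ, ← hr]; rfl
  -- The defining equation of α, cleared of denominators.
  have hJ2 : σ * MCD.radialMoment k (fun u => h (u ^ 2)) 2 r = γ * k * α ^ 2 := by
    have : k - 1 + 2 = k + 1 := by omega
    rw [hσ, hα, MCD.radialMoment, this]
    field_simp
  have hν_pos : 0 < ν₀ := by rw [hν]; positivity
  have hlt0 : σ * (h (r ^ 2) * (r ^ k / k)) < γ := by
    have := MCD.pow_div_lt_integral h_anti h_unimodal (k - 1) (hint _)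
    rw [← Nat.cast_add_one, Nat.sub_add_cancel hk] at this
    rw [← hJ0]
    exact mul_lt_mul_of_pos_left this hσ0
  have hlt2 : σ * (h (r ^ 2) * (r ^ (k + 2) / (k + 2))) < γ * k * α ^ 2 := by
    have := MCD.pow_div_lt_integral h_anti h_unimodal (k - 1 + 2) (hint _)
    rw [← Nat.cast_add_one, show k - 1 + 2 + 1 = k + 2 by omega] at this
    rw [← hJ2]
    push_cast at this
    exact mul_lt_mul_of_pos_left this hσ0
  have hrk : r ^ k = r ^ (k - 1) * r := by rw [← pow_succ, Nat.sub_add_cancel hk]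
  have hβ₁neg : β₁ < 0 := by
    have e : r / α / k * ν₀ = σ * (h (r ^ 2) * (r ^ k / k)) := by
      rw [hν, hrk]; field_simp
    rw [hβ₁, e]
    exact mul_neg_of_pos_of_neg (by positivity) (by linarith)
  have hβ₂neg : β₂ < 0 := by
    have e : 2 * (r / α) ^ 3 * ν₀ / (α * k * (k + 2)) =
        2 / (α ^ 3 * k) * (σ * (h (r ^ 2) * (r ^ (k + 2) / (k + 2)))) := by
      rw [hν, pow_add, hrk]; field_simp
    have e' : 2 * γ / α = 2 / (α ^ 3 * k) * (γ * k * α ^ 2) := by field_simp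
    rw [hβ₂, e, e', ← mul_sub]
    exact mul_neg_of_pos_of_neg (by positivity) (by linarith)
  have hβ₆pos : 0 < β₆ := by rw [hβ₆]; exact hν_pos
  refine ⟨by rw [hν, hσ], hβ₁neg, hβ₂neg, hβ₆pos, ?_⟩
  have hβ₁0 : β₁ ≠ 0 := hβ₁neg.ne
  have hβ₂0 : β₂ ≠ 0 := hβ₂neg.ne
  have hβ₆0 : β₆ ≠ 0 := hβ₆pos.ne'
  -- The determinant of D on span(I) × ℝ in the basis (I, 1); this is where 2γβ₆/α in the inverse
  -- comes from.
  have hdet : (β₂ + k * β₃) * β₆ - k * β₄ * β₅ = -(2 * γ / α) * β₆ := by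
    rw [hβ₂, hβ₃, hβ₄, hβ₅, hβ₆]
    field_simp
    ring
  have hdet' : α * ((β₂ + k * β₃) * β₆ - k * β₄ * β₅) = -(2 * γ) * β₆ := by
    rw [hdet]; field_simp
  set c₁ := α * (β₃ * β₆ - β₄ * β₅) / (2 * γ * β₂ * β₆) with hc₁
  set c₂ := α * β₄ / (2 * γ * β₆) with hc₂
  set c₃ := α * β₅ / (2 * γ * β₆) with hc₃
  set c₄ := α * (β₂ + k * β₃) / (2 * γ * β₆) with hc₄
  have hinv₁ : MCD.blockMap k β₁ β₂ β₃ β₄ β₅ β₆ ∘ₗ MCD.blockMap k β₁⁻¹ β₂⁻¹ c₁ c₂ c₃ (-c₄) =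
      LinearMap.id := by
    refine MCD.blockMap_comp_eq_id (mul_inv_cancel₀ hβ₁0) (mul_inv_cancel₀ hβ₂0) ?_ ?_ ?_ ?_
    · rw [hc₁, hc₃]
      field_simp
      linear_combination β₃ * hdet'
    · rw [hc₂, hc₄]
      field_simp
      ring
    · rw [hc₁, hc₃]
      field_simp
      linear_combination β₅ * hdet'
    · rw [hc₂, hc₄]
      field_simp
      linear_combination -hdet'
  have hinv₂ : MCD.blockMap k β₁⁻¹ β₂⁻¹ c₁ c₂ c₃ (-c₄) ∘ₗ MCD.blockMap k β₁ β₂ β₃ β₄ β₅ β₆ =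
      LinearMap.id :=
    -- In finite dimension a one-sided inverse is two-sided.
    (LinearMap.comp_eq_id_comm _ _).1 hinv₁
  let D : MCD.Param k ≃L[ℝ] MCD.Param k :=
    (LinearEquiv.ofLinearMap _ _ hinv₁ hinv₂).toContinuousLinearEquiv
  refine ⟨D, ?_, fun η A s => rfl, fun g B t => ?_⟩
  · have hP' : P = MeasureTheory.volume.withDensity fun x : MCD.Vec k =>
        ENNReal.ofReal (h (‖x‖ ^ 2)) := by
      rw [hPf]; simp_rw [hf]
    have hD : ∀ v, D v = MCD.blockMap k β₁ β₂ β₃ β₄ β₅ β₆ v := fun _ => rfl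
    refine MCD.hasFDerivAt_Lambda (g := fun u => h (u ^ 2)) (ν := ν₀) hk hα0 hρ hg hg0 hle hP' hgc γ
      ?_ _ (fun v i => ?_) (fun v i j => ?_) (fun v => ?_)
    · rw [hαr, hν]
      ring
    · change (D v).1 i = _
      rw [hD, MCD.blockMap_apply, hαr, ← hσdef, hJ0, ← hβ₁]
      rfl
    -- The choice of α is what turns the second-moment bulk term into γ.
    · have e : σ * MCD.radialMoment k (fun u => h (u ^ 2)) 2 r / (k * α ^ 2) = γ := by
        rw [hJ2]; field_simp
      change ((D v).2.1 : Matrix (Fin k) (Fin k) ℝ) i j = _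
      rw [hD, MCD.blockMap_apply, hαr, ← hσdef, e, ← hβ₂, ← hβ₃, ← hβ₄]
      rfl
    · change (D v).2.2 = _
      rw [hD, MCD.blockMap_apply, ← hβ₅, hβ₆]
  · change MCD.blockMap k β₁⁻¹ β₂⁻¹ c₁ c₂ c₃ (-c₄) (g, B, t) = _
    rw [MCD.blockMap_apply, neg_mul, ← sub_eq_add_neg]
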